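/- Partitions are weakly decreasing finite sequences of positive integers (the empty partition is included), and $s_\lambda=\sum_T x^T$ denotes the Schur function of $\lambda$, the sum over all semistandard Young tableaux $T$ of shape $\lambda$ (complex coefficients, infinitely many variables). For partitions $\mu,\nu$ the product has a unique expansion $s_\mu s_\nu=\sum_\lambda c^\lambda_{\mu,\nu}s_\lambda$ as a finite linear combination of Schur functions; the $c^\lambda_{\mu,\nu}$ are the Littlewood–Richardson coefficients. The code of a partition $\lambda$ is the doubly infinite sequence of letters U and R obtained by placing the Young diagram of $\lambda$, top and left aligned, in the fourth quadrant, and tracing up the negative $y$-axis to the bottom of the diagram, along its lower right edge, and then right along the positive $x$-axis; U stands for a unit step up and R for a unit step to the right. Let $u_i(\lambda)$ be the number of U's to the right of the $i$-th R from the left (the number of parts of size at least $i$), and let $r_i(\lambda)$ be the number of R's to the left of the $i$-th U from the right (so $r_i(\lambda)=\lambda_i$). **Theorem (Littlewood–Richardson rule in terms of codes).** Let $\mu,\nu$ be partitions and $l=u_1(\nu)$. Then $$s_\mu s_\nu=\sum_\lambda c^\lambda_{\mu,\nu}s_\lambda=\sum_{(\mu=\mu^0,\mu^1,\ldots,\mu^l)}s_{\mu^l},$$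 where the last sum is finite and runs over all sequences of partitions $\mu=\mu^0,\mu^1,\dots,\mu^l$ with the following properties. 1. For $1\le i\le l$, the code of $\mu^i$ is obtained from the code of $\mu^{i-1}$ as follows: starting with the U just left of the leftmost R in the code of $\mu^{i-1}$ and working to the right, move each U some number (possibly zero) of places to the right by switching UR to RU, with $r_i(\nu)$ switches in total. (So no U moves past the starting point of the next U.) 2. Let $k(i,j)$ be the number of switches made in step $i$ using the last $j$ U's, i.e. the $j$ rightmost ones; in particular $k(i,0)=0$. Then $k(i,j)\le k(i-1,j-1)$ for all $2\le i\le l$ and all $j\ge1$. Consequently, for every partition $\lambda$, $c^\lambda_{\mu,\nu}$ is the number of such sequences with $\mu^l=\lambda$. -/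

import Mathlib

/-! Partitions are Young diagrams (Mathlib's `YoungDiagram`, rows and columns numbered from `0`,
the empty partition included). -/

namespace CodeLR

/-- The two letters of a code: a unit step to the right, a unit step up. -/
inductive Letter where
  | R : Letter
  | U : Letter

/-- A doubly infinite sequence of letters. -/
abbrev Code := ℤ → Letter

open Classical in
/-- The code of a partition `lam`. Trace the boundary of the diagram (fourth quadrant, row `a`
between the heights `-(a+1)` and `-a`) from the negative `y`-axis to the positive `x`-axis. Every
unit step raises `x + y` by one, and the letter at place `p` is the step that starts on the line
`x + y = p`. The up steps are those at the right ends of the rows `a`, from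
`(rowLen a, -(a+1))` to `(rowLen a, -a)`; rows with `rowLen a = 0` give the steps along the
negative `y`-axis. All other steps go right. -/
noncomputable def code (lam : YoungDiagram) : Code := fun p =>
  if ∃ a : ℕ, p = (lam.rowLen a : ℤ) - (a + 1) then Letter.U else Letter.R

/-- The right steps of the path are those at the lower ends of the columns `b`, from
`(b, -colLen b)` to `(b + 1, -colLen b)`. -/
theorem code_eq_R_iff (lam : YoungDiagram) (p : ℤ) :
    code lam p = Letter.R ↔ ∃ b : ℕ, p = (b : ℤ) - lam.colLen b := by
  have key : ∀ a b : ℕ, a < lam.colLen b ↔ b < lam.rowLen a := fun a b => by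
    rw [← YoungDiagram.mem_iff_lt_colLen, YoungDiagram.mem_iff_lt_rowLen]
  have hR : code lam p = Letter.R ↔ ¬ ∃ a : ℕ, p = (lam.rowLen a : ℤ) - (a + 1) := by
    unfold code
    split_ifs with h
    · simp [h]
    · simp [h]
  rw [hR]
  constructor
  · intro h
    push Not at h
    have hex : ∃ a : ℕ, (lam.rowLen a : ℤ) - (a + 1) < p := by
      obtain ⟨N, hN⟩ : ∃ N : ℕ, (lam.rowLen 0 : ℤ) - p ≤ N :=
        ⟨_, Int.self_le_toNat _⟩
      refine ⟨N, ?_⟩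
      have h1 := lam.rowLen_anti 0 N (Nat.zero_le _)
      omega
    classical
    have ha := Nat.find_spec hex
    have hmin := fun a' => @Nat.find_min _ _ hex a'
    generalize Nat.find hex = a at ha hmin
    obtain ⟨b, hb⟩ := Int.eq_ofNat_of_zero_le (show 0 ≤ p + a by omega)
    refine ⟨b, ?_⟩
    have h2 : ¬ a < lam.colLen b := by rw [key]; omega
    have h3 : a ≤ lam.colLen b := by
      rcases Nat.eq_zero_or_pos a with h0 | h0
      · omega
      · have h4 := hmin (a - 1) (by omega)
        have h5 := h (a - 1)
        have h6 : a - 1 < lam.colLen b := by rw [key]; omega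
        omega
    omega
  · rintro ⟨b, hb⟩ ⟨a, ha⟩
    have := key a b
    omega

/-- The letter at place `p` is the `j`-th U from the right. -/
def IsUFromRight (c : Code) (j : ℕ) (p : ℤ) : Prop :=
  c p = Letter.U ∧ {q : ℤ | p ≤ q ∧ c q = Letter.U}.encard = (j : ℕ∞)

/-- The letter at place `p` is the `i`-th R from the left. -/
def IsRFromLeft (c : Code) (i : ℕ) (p : ℤ) : Prop :=
  c p = Letter.R ∧ {q : ℤ | q ≤ p ∧ c q = Letter.R}.encard = (i : ℕ∞)

/-- `u_i(lam)`: the number of U's in the code to the right of the `i`-th R from the left. -/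
noncomputable def u (lam : YoungDiagram) (i : ℕ) : ℕ :=
  {q : ℤ | code lam q = Letter.U ∧ ∃ p, IsRFromLeft (code lam) i p ∧ p < q}.ncard

/-- `r_i(lam)`: the number of R's in the code to the left of the `i`-th U from the right. -/
noncomputable def r (lam : YoungDiagram) (i : ℕ) : ℕ :=
  {q : ℤ | code lam q = Letter.R ∧ ∃ p, IsUFromRight (code lam) i p ∧ q < p}.ncard

/-- Put `RU` at the places `p`, `p + 1`. It is only used where `UR` stands there. -/
def switchUR (c : Code) (p : ℤ) : Code :=
  Function.update (Function.update c p Letter.R) (p + 1) Letter.U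

/-- `MoveU c p d c'`: the U at place `p` of `c` is moved to the right by `d` successive switches
of `UR` to `RU`, and the result is `c'`. -/
inductive MoveU : Code → ℤ → ℕ → Code → Prop where
  | zero (c : Code) (p : ℤ) : c p = Letter.U → MoveU c p 0 c
  | succ (c c' : Code) (p : ℤ) (d : ℕ) : c p = Letter.U → c (p + 1) = Letter.R →
      MoveU (switchUR c p) (p + 1) d c' → MoveU c p (d + 1) c'

/-- `Sweep m N c c'`: the last `N` U's of `c` are moved one after the other, from the left to the
right, the `j`-th U from the right by `m j` switches, and the result is `c'`. When a U is moved,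
the next U to its right has not moved yet, and a U is only switched with R's, so that no U moves
past the starting point of the next U. -/
inductive Sweep (m : ℕ → ℕ) : ℕ → Code → Code → Prop where
  | zero (c : Code) : Sweep m 0 c c
  | succ (N : ℕ) (c c₁ c' : Code) (p : ℤ) : IsUFromRight c (N + 1) p →
      MoveU c p (m (N + 1)) c₁ → Sweep m N c₁ c' → Sweep m (N + 1) c c'

/-- `IsStep al be n m`: the code of `be` is obtained from the code of `al` by `n` switches in one
sweep that starts with the U just left of the leftmost R (there are `u_1(al)` U's to the right of
that R, so this is the U with number `u_1(al) + 1` from the right); `m j` is the number of switches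
made using the `j`-th U from the right (no other U moves, and there is no U with number `0`). -/
def IsStep (al be : YoungDiagram) (n : ℕ) (m : ℕ → ℕ) : Prop :=
  Sweep m (u al 1 + 1) (code al) (code be) ∧
    (∀ j, j ∉ Finset.Icc 1 (u al 1 + 1) → m j = 0) ∧
    ∑ j ∈ Finset.Icc 1 (u al 1 + 1), m j = n

/-- `k(i,j)`: the number of switches made in step `i` using the last `j` U's, when `m i t` is the
number of switches made in step `i` using the `t`-th U from the right. -/
def k (m : ℕ → ℕ → ℕ) (i j : ℕ) : ℕ := ∑ t ∈ Finset.Icc 1 j, m i t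

/-- The sequences `mu = mu^0, mu^1, …, mu^l`, `l = u_1(nu)`, of the rule. The numbers `m i t` of
switches are determined by the sequence. Steps are numbered from `1`, so `k(i-1, j-1)` is there for
`i ≥ 2` and `j ≥ 1`. -/
def IsLRSequence (mu nu : YoungDiagram) (q : Fin (u nu 1 + 1) → YoungDiagram) : Prop :=
  q 0 = mu ∧ ∃ m : ℕ → ℕ → ℕ,
    (∀ i : Fin (u nu 1), IsStep (q i.castSucc) (q i.succ) (r nu (i + 1)) (m (i + 1))) ∧
    ∀ i j : ℕ, 2 ≤ i → i ≤ u nu 1 → 1 ≤ j → k m i j ≤ k m (i - 1) (j - 1)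

/-- The exponent of the monomial `x^T` of a semistandard tableau `T`. -/
noncomputable def content {lam : YoungDiagram} (T : SemistandardYoungTableau lam) : ℕ →₀ ℕ :=
  ∑ b ∈ lam.cells, Finsupp.single (T b.1 b.2) 1

/-- The Schur function `s_lam = ∑_T x^T`, the sum over all semistandard tableaux `T` of shape
`lam`, in the variables `x_0, x_1, x_2, …`: the coefficient at `x^d` is the (finite) number of
tableaux with content `d`. -/
noncomputable def schur (lam : YoungDiagram) : MvPowerSeries ℕ ℂ := fun d =>
  (Nat.card {T : SemistandardYoungTableau lam // content T = d} : ℂ)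

/-- `f = ∑_lam c_lam s_lam`, a finite linear combination of Schur functions. For
`f = s_mu s_nu` the numbers `c_lam` are the Littlewood–Richardson coefficients. -/
def IsSchurExpansion (f : MvPowerSeries ℕ ℂ) (c : YoungDiagram →₀ ℂ) : Prop :=
  f = c.sum fun lam a => a • schur lam

end CodeLR

open CodeLR

/-! The code of a partition amounts to the strictly decreasing sequence of its U-places `rowLen a -
(a + 1)`. In these coordinates a sweep raises every place without reaching the old place of the next
U to the right, so a step adds a horizontal strip (`isStep_iff`). Put `g s i = k(i+1, s)`, the
number of cells of strip `i` (counted from `0`) in the first `s` rows. Condition 2 then reads `g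
(s+1) (i+1) ≤ g s i`: the numbers form a Gelfand–Tsetlin pattern of shape `nu`, the companion
tableau of the sequence. That the skew pieces are horizontal strips is the condition `Dominant`
relative to `mu`. Thus `pattern` is a bijection from the sequences to the dominant patterns
(`isGT_pattern`, `dominant_pattern`, `pattern_injOn`, `exists_pattern_eq`).

These patterns are counted with alternants `a_α = det (x_i ^ α_j)` in `n` variables. Bender–Knuth
involutions make the Schur polynomial symmetric (`rename_schurPoly`), so `s_nu * a_(mu+ρ)` is the
sum of `a_(mu+wt(g)+ρ)` over all patterns `g` of shape `nu`. The terms that are not dominant cancel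
(`sum_alt_not_dominant`): read the rows from top to bottom, each from right to left, stop where the
content added to `mu` first fails to be a partition, and apply a Bender–Knuth involution to the
unread part; this swaps two exponents of the alternant. For `mu = 0` only one pattern survives,
giving the bialternant formula `s_nu * a_ρ = a_(nu+ρ)` (`schurPoly_mul_alt_rho`). Hence `s_mu * s_nu
* a_ρ` is the sum of `s_lam * a_ρ` over the ends `lam` of the sequences, and `a_ρ` cancels.

The identity passes to infinitely many variables coefficient by coefficient, with `n` large
(`schur_mul_schur`). Linear independence of Schur functions, also read off from alternants, makes
the coefficients unique. -/

namespace CodeLR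

/-! ### Codes as strictly decreasing sequences of U-places -/

open Classical in
/-- The code with its U's at the places `f 0 > f 1 > …`. -/
noncomputable def codeOf (f : ℕ → ℤ) : Code := fun p =>
  if ∃ a, p = f a then Letter.U else Letter.R

theorem codeOf_eq_U_iff {f : ℕ → ℤ} {p : ℤ} : codeOf f p = Letter.U ↔ ∃ a, p = f a := by
  unfold codeOf
  split_ifs with h <;> simp [h]

theorem codeOf_eq_R_iff {f : ℕ → ℤ} {p : ℤ} : codeOf f p = Letter.R ↔ ∀ a, p ≠ f a := by
  unfold codeOf
  split_ifs with h <;> simp_all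

theorem code_ext {c c' : Code} (h : ∀ p, c p = Letter.U ↔ c' p = Letter.U) : c = c' := by
  funext p
  have := h p
  cases h1 : c p <;> cases h2 : c' p <;> simp_all

theorem codeOf_inj {f f' : ℕ → ℤ} (hf : StrictAnti f) (hf' : StrictAnti f') :
    codeOf f = codeOf f' ↔ f = f' := by
  refine ⟨fun h => ?_, fun h => h ▸ rfl⟩
  have h1 : Set.range f = Set.range f' := by
    ext p
    have h2 := congrFun h p
    have h3 := codeOf_eq_U_iff (f := f) (p := p)
    rw [h2, codeOf_eq_U_iff] at h3
    simp only [Set.mem_range, eq_comm (b := p)]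
    exact h3.symm
  have h2 := (StrictMono.range_inj (f := fun a => -f a) (g := fun a => -f' a)
    (fun a b hab => neg_lt_neg (hf hab)) (fun a b hab => neg_lt_neg (hf' hab))).mp (by
      have h3 := congrArg (fun s => Neg.neg '' s) h1
      rwa [← Set.range_comp, ← Set.range_comp] at h3)
  funext a
  have := congrFun h2 a
  simpa using this

/-- The place of the U at the end of row `a`. -/
def upPlace (lam : YoungDiagram) (a : ℕ) : ℤ := (lam.rowLen a : ℤ) - (a + 1)

theorem code_eq_codeOf (lam : YoungDiagram) : code lam = codeOf (upPlace lam) := rfl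

theorem strictAnti_upPlace (lam : YoungDiagram) : StrictAnti (upPlace lam) := by
  intro a b hab
  have := lam.rowLen_anti a b hab.le
  simp only [upPlace]
  omega

/-- The U's at or to the right of `f a` are exactly `f 0, …, f a`. The 1-based count of the code
meets the 0-based index of rows here. -/
theorem isUFromRight_codeOf_iff {f : ℕ → ℤ} (hf : StrictAnti f) (N : ℕ) (p : ℤ) :
    IsUFromRight (codeOf f) (N + 1) p ↔ p = f N := by
  have key : ∀ a, {q : ℤ | f a ≤ q ∧ codeOf f q = Letter.U}.encard = ((a + 1 : ℕ) : ℕ∞) := by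
    intro a
    have h1 : {q : ℤ | f a ≤ q ∧ codeOf f q = Letter.U} =
        ((Finset.range (a + 1)).image f : Finset ℤ) := by
      ext q
      simp only [Set.mem_ofPred_eq, codeOf_eq_U_iff, Finset.coe_image, Finset.coe_range,
        Set.mem_image, Set.mem_Iio]
      constructor
      · rintro ⟨h, b, rfl⟩
        exact ⟨b, Nat.lt_succ_of_le (hf.le_iff_ge.mp h), rfl⟩
      · rintro ⟨b, hb, rfl⟩
        exact ⟨hf.le_iff_ge.mpr (Nat.le_of_lt_succ hb), b, rfl⟩
    rw [h1, Set.encard_coe_eq_coe_finsetCard, Finset.card_image_of_injective _ hf.injective,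
      Finset.card_range]
  constructor
  · rintro ⟨h1, h2⟩
    obtain ⟨a, rfl⟩ := codeOf_eq_U_iff.mp h1
    rw [key a] at h2
    have h3 : a + 1 = N + 1 := by exact_mod_cast h2
    rw [show a = N by omega]
  · rintro rfl
    exact ⟨codeOf_eq_U_iff.mpr ⟨N, rfl⟩, key N⟩

theorem switchUR_codeOf {f : ℕ → ℤ} (hf : StrictAnti f) (N : ℕ) :
    switchUR (codeOf f) (f N) = codeOf (Function.update f N (f N + 1)) := by
  refine code_ext fun p => ?_
  rw [codeOf_eq_U_iff]
  by_cases h1 : p = f N + 1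
  · subst h1
    simp only [switchUR, Function.update_self, true_iff]
    exact ⟨N, by simp⟩
  by_cases h2 : p = f N
  · subst h2
    simp only [switchUR, Function.update_of_ne h1, Function.update_self, reduceCtorEq, false_iff,
      not_exists]
    intro a
    by_cases ha : a = N
    · subst ha; simp
    · rw [Function.update_of_ne ha]
      exact fun h => ha (hf.injective h.symm)
  · simp only [switchUR, Function.update_of_ne h1, Function.update_of_ne h2, codeOf_eq_U_iff]
    refine exists_congr fun a => ?_
    by_cases ha : a = N
    · subst ha; simp [h1, h2]
    · rw [Function.update_of_ne ha]

theorem strictAnti_update {f : ℕ → ℤ} (hf : StrictAnti f) {N d : ℕ}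
    (h : ∀ a, a + 1 = N → f N + d < f a) :
    StrictAnti (Function.update f N (f N + d)) := by
  refine strictAnti_nat_of_succ_lt fun a => ?_
  have h1 := hf (show a < a + 1 by omega)
  by_cases h2 : a = N
  · subst h2
    rw [Function.update_self, Function.update_of_ne (by omega)]
    omega
  · rw [Function.update_of_ne h2]
    by_cases h3 : a + 1 = N
    · rw [h3, Function.update_self]
      exact h a h3
    · rw [Function.update_of_ne h3]
      exact h1

/-- The only obstacle is the next U to the right, at `f (N - 1)`. The condition `a + 1 = N` is
vacuous for `N = 0`: the rightmost U moves freely. -/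
theorem moveU_codeOf_iff {f : ℕ → ℤ} (hf : StrictAnti f) (N d : ℕ) (c' : Code) :
    MoveU (codeOf f) (f N) d c' ↔
      (∀ a, a + 1 = N → f N + d < f a) ∧ c' = codeOf (Function.update f N (f N + d)) := by
  induction d generalizing f with
  | zero =>
    constructor
    · intro h
      cases h
      refine ⟨fun a ha => ?_, by simp⟩
      have := hf (show a < N by omega)
      simpa using this
    · rintro ⟨_, rfl⟩
      simpa using MoveU.zero (codeOf f) (f N) (codeOf_eq_U_iff.mpr ⟨N, rfl⟩)
  | succ d ih =>
    have hR : codeOf f (f N + 1) = Letter.R ↔ ∀ a, a + 1 = N → f N + (1 : ℕ) < f a := by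
      rw [codeOf_eq_R_iff]
      constructor
      · intro h a ha
        have h1 := hf (show a < N by omega)
        have h2 := h a
        push_cast
        omega
      · intro h a ha
        have h1 : a < N := hf.lt_iff_gt.mp (by omega)
        have h2 := h (N - 1) (by omega)
        have h3 : f (N - 1) ≤ f a := hf.antitone (by omega)
        push_cast at h2
        omega
    have hstep : ∀ (h : ∀ a, a + 1 = N → f N + (1 : ℕ) < f a),
        MoveU (switchUR (codeOf f) (f N)) (f N + 1) d c' ↔
        (∀ a, a + 1 = N → f N + (d + 1 : ℕ) < f a) ∧
          c' = codeOf (Function.update f N (f N + (d + 1 : ℕ))) := by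
      intro h
      have h1 := strictAnti_update hf h
      have h2 := ih h1
      have h3 := switchUR_codeOf hf N
      simp only [Function.update_self, Function.update_idem, Nat.cast_one] at h2
      rw [h3, h2]
      have e : f N + 1 + (d : ℤ) = f N + (d + 1 : ℕ) := by push_cast; ring
      rw [e]
      refine and_congr_left fun _ => forall_congr' fun a => forall_congr' fun ha => ?_
      rw [Function.update_of_ne (by omega)]
    constructor
    · intro hm
      cases hm with
      | succ _ _ _ _ hU hR' hm => exact (hstep (hR.mp hR')).mp hm
    · intro h
      have h1 : ∀ a, a + 1 = N → f N + (1 : ℕ) < f a := fun a ha => by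
        have := h.1 a ha
        push_cast at this ⊢
        omega
      exact MoveU.succ _ _ _ _ (codeOf_eq_U_iff.mpr ⟨N, rfl⟩) (hR.mpr h1) ((hstep h1).mpr h)

/-- As the sweep runs from left to right, each U is bounded by the unmoved place of its right
neighbour. The conditions therefore involve only the original `f`, and all moves can be added at
once. -/
theorem sweep_codeOf_iff (m : ℕ → ℕ) {f : ℕ → ℤ} (hf : StrictAnti f) (N : ℕ) (c' : Code) :
    Sweep m N (codeOf f) c' ↔
      (∀ a, a + 1 < N → f (a + 1) + m (a + 2) < f a) ∧
        c' = codeOf (fun a => if a < N then f a + m (a + 1) else f a) := by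
  induction N generalizing f with
  | zero =>
    constructor
    · intro h
      cases h
      simp
    · rintro ⟨_, rfl⟩
      simpa using Sweep.zero (m := m) (codeOf f)
  | succ N ih =>
    have hstep : ∀ (h : ∀ a, a + 1 = N → f N + m (N + 1) < f a),
        Sweep m N (codeOf (Function.update f N (f N + m (N + 1)))) c' ↔
        (∀ a, a + 1 < N + 1 → f (a + 1) + m (a + 2) < f a) ∧
        c' = codeOf (fun a => if a < N + 1 then f a + m (a + 1) else f a) := by
      intro h
      rw [ih (strictAnti_update hf h)]
      have e : (fun a => if a < N then Function.update f N (f N + m (N + 1)) a + m (a + 1)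
          else Function.update f N (f N + m (N + 1)) a) =
          fun a => if a < N + 1 then f a + m (a + 1) else f a := by
        funext a
        rcases lt_trichotomy a N with ha | rfl | ha
        · rw [if_pos ha, if_pos (by omega), Function.update_of_ne (by omega)]
        · simp
        · rw [if_neg (by omega), if_neg (by omega), Function.update_of_ne (by omega)]
      rw [e]
      refine and_congr_left fun _ => ?_
      constructor
      · intro h1 a ha
        by_cases haN : a + 1 = N
        · have := h a haN
          rw [← haN] at this
          exact this
        · have := h1 a (by omega)
          rwa [Function.update_of_ne (by omega), Function.update_of_ne (by omega)] at this
      · intro h1 a ha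
        rw [Function.update_of_ne (by omega), Function.update_of_ne (by omega)]
        exact h1 a (by omega)
    constructor
    · intro hs
      cases hs with
      | succ _ _ c₁ _ p hU hm hs =>
        obtain rfl := (isUFromRight_codeOf_iff hf N p).mp hU
        obtain ⟨h1, rfl⟩ := (moveU_codeOf_iff hf N _ _).mp hm
        exact (hstep h1).mp hs
    · intro h
      have h1 : ∀ a, a + 1 = N → f N + m (N + 1) < f a := fun a ha => by
        have := h.1 a (by omega)
        subst ha
        exact this
      exact Sweep.succ N _ _ _ _ ((isUFromRight_codeOf_iff hf N _).mpr rfl)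
        ((moveU_codeOf_iff hf N _ _).mpr ⟨h1, rfl⟩) ((hstep h1).mpr h)

/-! ### Codes of partitions; steps as horizontal strips -/

theorem lt_colLen_iff {lam : YoungDiagram} {a b : ℕ} : a < lam.colLen b ↔ b < lam.rowLen a := by
  rw [← YoungDiagram.mem_iff_lt_colLen, YoungDiagram.mem_iff_lt_rowLen]

theorem downPlace_injective (lam : YoungDiagram) :
    Function.Injective fun b : ℕ => (b : ℤ) - lam.colLen b := by
  intro b b' h
  dsimp only at h
  rcases le_total b b' with hb | hb
  · have := lam.colLen_anti b b' hb
    omega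
  · have := lam.colLen_anti b' b hb
    omega

theorem isRFromLeft_one_iff (lam : YoungDiagram) (p : ℤ) :
    IsRFromLeft (code lam) 1 p ↔ p = -(lam.colLen 0 : ℤ) := by
  have key : ∀ b : ℕ, {q : ℤ | q ≤ (b : ℤ) - lam.colLen b ∧ code lam q = Letter.R} =
      ((Finset.range (b + 1)).image fun b : ℕ => (b : ℤ) - lam.colLen b : Finset ℤ) := by
    intro b
    ext q
    simp only [Set.mem_ofPred_eq, code_eq_R_iff, Finset.coe_image, Finset.coe_range,
      Set.mem_image, Set.mem_Iio]
    constructor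
    · rintro ⟨h, b', rfl⟩
      refine ⟨b', ?_, rfl⟩
      by_contra hb
      have := lam.colLen_anti b b' (by omega)
      omega
    · rintro ⟨b', hb, rfl⟩
      have := lam.colLen_anti b' b (by omega)
      exact ⟨by omega, b', rfl⟩
  have hinj := downPlace_injective lam
  have hcard : ∀ b : ℕ, {q : ℤ | q ≤ (b : ℤ) - lam.colLen b ∧ code lam q = Letter.R}.encard =
      ((b + 1 : ℕ) : ℕ∞) := fun b => by
    rw [key, Set.encard_coe_eq_coe_finsetCard, Finset.card_image_of_injective _ hinj,
      Finset.card_range]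
  constructor
  · rintro ⟨h1, h2⟩
    obtain ⟨b, rfl⟩ := (code_eq_R_iff lam p).mp h1
    rw [hcard b] at h2
    have h3 : b + 1 = 1 := by exact_mod_cast h2
    obtain rfl : b = 0 := by omega
    simp
  · rintro rfl
    have h1 := hcard 0
    simp only [Nat.cast_zero, zero_sub, zero_add] at h1
    exact ⟨(code_eq_R_iff lam _).mpr ⟨0, by simp⟩, h1⟩

theorem u_one (lam : YoungDiagram) : u lam 1 = lam.colLen 0 := by
  have h1 : {q : ℤ | code lam q = Letter.U ∧ ∃ p, IsRFromLeft (code lam) 1 p ∧ p < q} =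
      ((Finset.range (lam.colLen 0)).image (upPlace lam) : Finset ℤ) := by
    ext q
    simp only [Set.mem_ofPred_eq, isRFromLeft_one_iff, exists_eq_left]
    simp only [code_eq_codeOf, codeOf_eq_U_iff, Finset.coe_image, Finset.coe_range, Set.mem_image, Set.mem_Iio]
    have key : ∀ a, -(lam.colLen 0 : ℤ) < upPlace lam a ↔ a < lam.colLen 0 := fun a => by
      have h1 := lt_colLen_iff (lam := lam) (a := a) (b := 0)
      simp only [upPlace]
      constructor
      · intro h
        by_contra hc
        omega
      · intro h
        omega
    constructor
    · rintro ⟨⟨a, rfl⟩, h⟩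
      exact ⟨a, (key a).mp h, rfl⟩
    · rintro ⟨a, ha, rfl⟩
      exact ⟨⟨a, rfl⟩, (key a).mpr ha⟩
  rw [u, h1, Set.ncard_coe_finset,
    Finset.card_image_of_injective _ (strictAnti_upPlace lam).injective, Finset.card_range]

theorem r_succ (lam : YoungDiagram) (i : ℕ) : r lam (i + 1) = lam.rowLen i := by
  have hinj := downPlace_injective lam
  have h1 : {q : ℤ | code lam q = Letter.R ∧ ∃ p, IsUFromRight (code lam) (i + 1) p ∧ q < p} =
      ((Finset.range (lam.rowLen i)).image fun b : ℕ => (b : ℤ) - lam.colLen b : Finset ℤ) := by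
    ext q
    simp only [code_eq_codeOf, isUFromRight_codeOf_iff (strictAnti_upPlace lam), exists_eq_left,
      Set.mem_ofPred_eq, Finset.coe_image, Finset.coe_range, Set.mem_image, Set.mem_Iio]
    simp only [← code_eq_codeOf, code_eq_R_iff]
    have key : ∀ b : ℕ, (b : ℤ) - lam.colLen b < upPlace lam i ↔ b < lam.rowLen i := fun b => by
      have h1 := lt_colLen_iff (lam := lam) (a := i) (b := b)
      simp only [upPlace]
      constructor
      · intro h
        by_contra hc
        omega
      · intro h
        omega
    constructor
    · rintro ⟨⟨a, rfl⟩, h⟩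
      exact ⟨a, (key a).mp h, rfl⟩
    · rintro ⟨a, ha, rfl⟩
      exact ⟨⟨a, rfl⟩, (key a).mpr ha⟩
  rw [r, h1, Set.ncard_coe_finset, Finset.card_image_of_injective _ hinj, Finset.card_range]

/-- A step adds a horizontal strip with `m (a + 1)` cells in row `a`. -/
theorem isStep_iff (al be : YoungDiagram) (n : ℕ) (m : ℕ → ℕ) :
    IsStep al be n m ↔ (∀ a, be.rowLen a = al.rowLen a + m (a + 1)) ∧
      (∀ a, be.rowLen (a + 1) ≤ al.rowLen a) ∧ m 0 = 0 ∧
      ∑ a ∈ Finset.range (al.colLen 0 + 1), m (a + 1) = n := by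
  have hsum : ∑ j ∈ Finset.Icc 1 (al.colLen 0 + 1), m j =
      ∑ a ∈ Finset.range (al.colLen 0 + 1), m (a + 1) := by
    rw [← Finset.Ico_add_one_right_eq_Icc, Finset.sum_Ico_eq_sum_range]
    exact Finset.sum_congr (by simp) fun a _ => by rw [add_comm]
  have hsa : (∀ a, a + 1 < al.colLen 0 + 1 → upPlace al (a + 1) + m (a + 2) < upPlace al a) →
      StrictAnti fun a =>
        if a < al.colLen 0 + 1 then upPlace al a + m (a + 1) else upPlace al a := by
    intro h
    refine strictAnti_nat_of_succ_lt fun a => ?_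
    have h1 := strictAnti_upPlace al (Nat.lt_succ_self a)
    have h2 := h a
    split_ifs with h3 h4 <;> simp only [Nat.succ_eq_add_one, add_assoc, Nat.reduceAdd] at * <;>
      omega
  rw [IsStep, u_one, code_eq_codeOf, code_eq_codeOf, sweep_codeOf_iff m (strictAnti_upPlace al),
    hsum]
  constructor
  · rintro ⟨⟨h1, h2⟩, h3, h4⟩
    rw [codeOf_inj (strictAnti_upPlace be) (hsa h1)] at h2
    have h5 : ∀ a, be.rowLen a = al.rowLen a + m (a + 1) := fun a => by
      have h6 := congrFun h2 a
      simp only [upPlace] at h6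
      split_ifs at h6 with ha
      · omega
      · rw [h3 (a + 1) (by simp; omega)]
        omega
    refine ⟨h5, fun a => ?_, h3 0 (by simp), h4⟩
    by_cases ha : a + 1 < al.colLen 0 + 1
    · have h6 := h1 a ha
      have h7 := h5 (a + 1)
      simp only [upPlace] at h6
      push_cast at h6
      change be.rowLen (a + 1) = al.rowLen (a + 1) + m (a + 2) at h7
      omega
    · have h6 := h5 (a + 1)
      rw [h3 (a + 1 + 1) (by simp; omega)] at h6
      have := al.rowLen_anti a (a + 1) (by omega)
      omega
  · rintro ⟨h1, h2, h3, h4⟩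
    have h5 : ∀ j, j ∉ Finset.Icc 1 (al.colLen 0 + 1) → m j = 0 := fun j hj => by
      rcases Nat.eq_zero_or_pos j with rfl | hj0
      · exact h3
      have hj1 : ¬ j ≤ al.colLen 0 + 1 := fun h => hj (Finset.mem_Icc.mpr ⟨hj0, h⟩)
      -- Row `a` of `al` is empty, so the strip condition leaves no room in row `a + 1`, whose U has
      -- number `a + 2`.
      obtain ⟨a, rfl⟩ : ∃ a, j = a + 2 := ⟨j - 2, by omega⟩
      have h6 := h2 a
      have h7 := h1 (a + 1)
      have h8 := lt_colLen_iff (lam := al) (a := a) (b := 0)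
      rw [show a + 1 + 1 = a + 2 from rfl] at h7
      omega
    have h6 : ∀ a, a + 1 < al.colLen 0 + 1 →
        upPlace al (a + 1) + m (a + 2) < upPlace al a := fun a _ => by
      have h6 := h2 a
      have h7 := h1 (a + 1)
      rw [show a + 1 + 1 = a + 2 from rfl] at h7
      simp only [upPlace]
      push_cast
      omega
    refine ⟨⟨h6, ?_⟩, h5, h4⟩
    rw [codeOf_inj (strictAnti_upPlace be) (hsa h6)]
    funext a
    have h7 := h1 a
    simp only [upPlace]
    split_ifs with ha
    · omega
    · rw [h5 (a + 1) (by simp; omega)] at h7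
      omega

/-! ### Gelfand–Tsetlin patterns -/

/-- Gelfand–Tsetlin patterns: `g s i` is the number of entries `< s` in row `i` of a semistandard
tableau with row lengths `nu` and entries `< n`. -/
structure IsGT (n : ℕ) (nu : ℕ → ℕ) (g : ℕ → ℕ → ℕ) : Prop where
  zero : ∀ i, g 0 i = 0
  mono : ∀ s i, g s i ≤ g (s + 1) i
  inter : ∀ s i, g (s + 1) (i + 1) ≤ g s i
  top : ∀ s, n ≤ s → ∀ i, g s i = nu i

namespace IsGT

variable {n : ℕ} {nu : ℕ → ℕ} {g : ℕ → ℕ → ℕ}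

theorem monotone (h : IsGT n nu g) (i : ℕ) : Monotone fun s => g s i :=
  monotone_nat_of_le_succ fun s => h.mono s i

/-- By column strictness, entries of row `i` are at least `i`. -/
theorem eq_zero (h : IsGT n nu g) : ∀ {s i : ℕ}, s ≤ i → g s i = 0
  | 0, i, _ => h.zero i
  | s + 1, 0, hs => by omega
  | s + 1, i + 1, hs => by
    have h1 := h.inter s i
    have h2 := h.eq_zero (show s ≤ i by omega)
    omega

theorem eq_zero_of_le (h : IsGT n nu g) {s i : ℕ} (hi : n ≤ i) : g s i = 0 := by
  rcases le_total s i with hs | hs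
  · exact h.eq_zero hs
  · rw [h.top s (by omega), ← h.top i hi]
    exact h.eq_zero le_rfl

theorem le_shape (h : IsGT n nu g) (s i : ℕ) : g s i ≤ nu i := by
  have h1 := h.monotone i (le_max_left s n)
  rw [← h.top (max s n) (le_max_right s n)]
  exact h1

theorem shape_antitone (h : IsGT n nu g) : Antitone nu :=
  antitone_nat_of_succ_le fun i => by
    have h1 := h.inter n i
    rwa [h.top (n + 1) (by omega), h.top n le_rfl] at h1

end IsGT

theorem finite_setOf_isGT (n : ℕ) (nu : ℕ → ℕ) : {g | IsGT n nu g}.Finite := by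
  let F : {g // IsGT n nu g} → (Fin n → Fin n → Fin (nu 0 + 1)) := fun g s i =>
    ⟨g.1 s i, Nat.lt_succ_of_le
      ((g.2.le_shape s i).trans (g.2.shape_antitone (Nat.zero_le _)))⟩
  refine Set.finite_coe_iff.mp (Finite.of_injective F fun g g' hg => ?_)
  ext s i
  rcases le_or_gt n s with hs | hs
  · rw [g.2.top s hs, g'.2.top s hs]
  rcases le_or_gt n i with hi | hi
  · rw [g.2.eq_zero_of_le hi, g'.2.eq_zero_of_le hi]
  · simpa [F] using congrFun (congrFun hg ⟨s, hs⟩) ⟨i, hi⟩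

/-- The GT patterns with shape `nu` and entries `< n`. -/
noncomputable def gts (n : ℕ) (nu : ℕ → ℕ) : Finset (ℕ → ℕ → ℕ) :=
  (finite_setOf_isGT n nu).toFinset

@[simp] theorem mem_gts {n : ℕ} {nu : ℕ → ℕ} {g : ℕ → ℕ → ℕ} : g ∈ gts n nu ↔ IsGT n nu g := by
  simp [gts]

/-- The number of entries `< s` in the first `i` rows. -/
def rowSum (g : ℕ → ℕ → ℕ) (s i : ℕ) : ℕ := ∑ j ∈ Finset.range i, g s j

@[simp] theorem rowSum_zero (g : ℕ → ℕ → ℕ) (s : ℕ) : rowSum g s 0 = 0 := rfl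

theorem rowSum_succ (g : ℕ → ℕ → ℕ) (s i : ℕ) : rowSum g s (i + 1) = rowSum g s i + g s i :=
  Finset.sum_range_succ _ _

theorem IsGT.rowSum_mono {n : ℕ} {nu : ℕ → ℕ} {g : ℕ → ℕ → ℕ} (h : IsGT n nu g) (s i : ℕ) :
    rowSum g s i ≤ rowSum g (s + 1) i :=
  Finset.sum_le_sum fun j _ => h.mono s j

/-- The number of entries `t` in the first `i` rows, added to `mu t`. -/
def shapeAt (mu : ℕ → ℕ) (g : ℕ → ℕ → ℕ) (i t : ℕ) : ℕ :=
  mu t + (rowSum g (t + 1) i - rowSum g t i)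

theorem IsGT.shapeAt_add {n : ℕ} {nu : ℕ → ℕ} {g : ℕ → ℕ → ℕ} (h : IsGT n nu g)
    (mu : ℕ → ℕ) (i t : ℕ) :
    shapeAt mu g i t + rowSum g t i = mu t + rowSum g (t + 1) i := by
  have := h.rowSum_mono t i
  unfold shapeAt
  omega

theorem IsGT.shapeAt_succ {n : ℕ} {nu : ℕ → ℕ} {g : ℕ → ℕ → ℕ} (h : IsGT n nu g)
    (mu : ℕ → ℕ) (i t : ℕ) :
    shapeAt mu g (i + 1) t + g t i = shapeAt mu g i t + g (t + 1) i := by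
  have h1 := h.shapeAt_add mu i t
  have h2 := h.shapeAt_add mu (i + 1) t
  rw [rowSum_succ, rowSum_succ] at h2
  omega

theorem IsGT.shapeAt_le_succ {n : ℕ} {nu : ℕ → ℕ} {g : ℕ → ℕ → ℕ} (h : IsGT n nu g)
    (mu : ℕ → ℕ) (i t : ℕ) : shapeAt mu g i t ≤ shapeAt mu g (i + 1) t := by
  have h1 := h.shapeAt_succ mu i t
  have h2 := h.mono t i
  omega

/-! ### Bender–Knuth involutions -/

/-- The lower bound for `g (t + 1) i` given the neighbouring levels. -/
def lo (g : ℕ → ℕ → ℕ) (t i : ℕ) : ℕ := max (g t i) (g (t + 1 + 1) (i + 1))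

/-- The upper bound for `g (t + 1) i` given the neighbouring levels. -/
def hi (g : ℕ → ℕ → ℕ) (t : ℕ) : ℕ → ℕ
  | 0 => g (t + 1 + 1) 0
  | i + 1 => min (g (t + 1 + 1) (i + 1)) (g t i)

/-- The Bender–Knuth involution for the letters `t` and `t + 1`, restricted to the rows from
`i₀` on, where in row `i₀` only the first `c` columns are used. -/
def toggle (t i₀ c : ℕ) (g : ℕ → ℕ → ℕ) : ℕ → ℕ → ℕ := fun s i =>
  if s = t + 1 ∧ i₀ ≤ i then lo g t i + (if i = i₀ then c else hi g t i) - g s i else g s i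

section Toggle

variable {n : ℕ} {nu : ℕ → ℕ} {g : ℕ → ℕ → ℕ} {t i₀ c : ℕ}

theorem toggle_of_ne {s : ℕ} (hs : s ≠ t + 1) (i : ℕ) : toggle t i₀ c g s i = g s i := by
  simp [toggle, hs]

theorem toggle_of_lt (s : ℕ) {i : ℕ} (hi : i < i₀) : toggle t i₀ c g s i = g s i := by
  simp [toggle, hi]

theorem toggle_self : toggle t i₀ c g (t + 1) i₀ = lo g t i₀ + c - g (t + 1) i₀ := by
  simp [toggle]

theorem toggle_of_gt {i : ℕ} (h : i₀ < i) :
    toggle t i₀ c g (t + 1) i = lo g t i + hi g t i - g (t + 1) i := by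
  simp [toggle, h.le, h.ne']

theorem lo_toggle (i : ℕ) : lo (toggle t i₀ c g) t i = lo g t i := by
  simp [lo, toggle_of_ne]

theorem hi_toggle (i : ℕ) : hi (toggle t i₀ c g) t i = hi g t i := by
  cases i <;> simp [hi, toggle_of_ne]

theorem IsGT.lo_le (h : IsGT n nu g) (t i : ℕ) : lo g t i ≤ g (t + 1) i :=
  max_le (h.mono t i) (h.inter (t + 1) i)

theorem IsGT.le_hi (h : IsGT n nu g) (t : ℕ) : ∀ i, g (t + 1) i ≤ hi g t i
  | 0 => h.mono (t + 1) 0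
  | i + 1 => le_min (h.mono (t + 1) (i + 1)) (h.inter t i)

theorem hi_le (g : ℕ → ℕ → ℕ) (t : ℕ) : ∀ i, hi g t i ≤ g (t + 1 + 1) i
  | 0 => le_rfl
  | _ + 1 => min_le_left _ _

theorem hi_succ_le (g : ℕ → ℕ → ℕ) (t i : ℕ) : hi g t (i + 1) ≤ g t i := min_le_right _ _

/-- Both sides are sums of the same two numbers, as `min` plus `max`. This makes the row sums in
`IsGT.rowSum_toggle` telescope. -/
theorem hi_succ_add_lo (g : ℕ → ℕ → ℕ) (t i : ℕ) :
    hi g t (i + 1) + lo g t i = g (t + 1 + 1) (i + 1) + g t i := by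
  simp only [hi, lo]
  omega

theorem IsGT.toggle_bounds (h : IsGT n nu g) (h1 : g (t + 1) i₀ ≤ c) (h2 : c ≤ hi g t i₀)
    (i : ℕ) : lo g t i ≤ toggle t i₀ c g (t + 1) i ∧ toggle t i₀ c g (t + 1) i ≤ hi g t i := by
  have h3 := h.lo_le t i
  have h4 := h.le_hi t i
  rcases lt_trichotomy i i₀ with h5 | rfl | h5
  · rw [toggle_of_lt _ h5]
    exact ⟨h3, h4⟩
  · rw [toggle_self]
    omega
  · rw [toggle_of_gt h5]
    omega

/-- Only level `t + 1` changes, and its inequalities with the two neighbouring levels say just that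
each entry lies between `lo` and `hi`. So the rows can be reflected independently. -/
theorem IsGT.toggle (h : IsGT n nu g) (ht : t + 1 < n) (h1 : g (t + 1) i₀ ≤ c)
    (h2 : c ≤ hi g t i₀) : IsGT n nu (toggle t i₀ c g) where
  zero i := by rw [toggle_of_ne (by omega), h.zero]
  mono s i := by
    have h3 := h.toggle_bounds h1 h2 i
    have h4 := hi_le g t i
    have h5 : g t i ≤ lo g t i := le_max_left _ _
    by_cases hs : s = t + 1
    · subst hs
      rw [toggle_of_ne (s := t + 1 + 1) (by omega)]
      omega
    by_cases hs' : s = t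
    · subst hs'
      rw [toggle_of_ne (s := s) (by omega)]
      omega
    rw [toggle_of_ne hs, toggle_of_ne (by omega)]
    exact h.mono s i
  inter s i := by
    have h4 : g (t + 1 + 1) (i + 1) ≤ lo g t i := le_max_right _ _
    by_cases hs : s = t + 1
    · subst hs
      have h3 := h.toggle_bounds h1 h2 i
      rw [toggle_of_ne (s := t + 1 + 1) (by omega)]
      omega
    by_cases hs' : s = t
    · subst hs'
      have h3 := h.toggle_bounds h1 h2 (i + 1)
      have h5 := hi_succ_le g s i
      rw [toggle_of_ne (s := s) (by omega)]
      omega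
    rw [toggle_of_ne hs, toggle_of_ne (by omega)]
    exact h.inter s i
  top s hs i := by rw [toggle_of_ne (by omega), h.top s hs]

theorem IsGT.toggle_toggle (h : IsGT n nu g) (h1 : g (t + 1) i₀ ≤ c) :
    CodeLR.toggle t i₀ c (CodeLR.toggle t i₀ c g) = g := by
  funext s i
  by_cases hs : s = t + 1
  · subst hs
    have h3 := h.lo_le t i
    have h4 := h.le_hi t i
    rcases lt_trichotomy i i₀ with h5 | rfl | h5
    · rw [toggle_of_lt _ h5, toggle_of_lt _ h5]
    · rw [toggle_self, toggle_self, lo_toggle]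
      omega
    · rw [toggle_of_gt h5, toggle_of_gt h5, lo_toggle, hi_toggle]
      omega
  · rw [toggle_of_ne hs, toggle_of_ne hs]

theorem rowSum_toggle_of_ne {s : ℕ} (hs : s ≠ t + 1) (i : ℕ) :
    rowSum (toggle t i₀ c g) s i = rowSum g s i := by
  simp [rowSum, toggle_of_ne hs]

theorem rowSum_toggle_of_le (s : ℕ) {i : ℕ} (hi : i ≤ i₀) :
    rowSum (toggle t i₀ c g) s i = rowSum g s i :=
  Finset.sum_congr rfl fun j hj => toggle_of_lt s (by simp at hj; omega)

theorem shapeAt_toggle_of_le (mu : ℕ → ℕ) {i : ℕ} (hi : i ≤ i₀) (s : ℕ) :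
    shapeAt mu (toggle t i₀ c g) i s = shapeAt mu g i s := by
  simp [shapeAt, rowSum_toggle_of_le _ hi]

/-- In a reflected row the old and new values add up to `lo + hi`, which telescopes over the rows.
`K` accounts for the rows above `i₀` and the cut at `c`; it is `0` for the full Bender–Knuth
involution. -/
theorem IsGT.rowSum_toggle (h : IsGT n nu g) (ht : t + 1 < n) (h1 : g (t + 1) i₀ ≤ c)
    (hi₀ : i₀ < n) {K : ℤ}
    (hK : (2 * rowSum g (t + 1) i₀ + c : ℤ) =
      rowSum g t i₀ + rowSum g (t + 1 + 1) i₀ + g (t + 1 + 1) i₀ + K) :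
    (rowSum (CodeLR.toggle t i₀ c g) (t + 1) n + rowSum g (t + 1) n : ℤ) =
      rowSum g t n + rowSum g (t + 1 + 1) n + K := by
  have key : ∀ N, i₀ ≤ N →
      (rowSum (CodeLR.toggle t i₀ c g) (t + 1) (N + 1) + rowSum g (t + 1) (N + 1) : ℤ) =
      rowSum g t (N + 1) + rowSum g (t + 1 + 1) (N + 1) + K + (lo g t N - g t N) := by
    intro N hN
    induction N, hN using Nat.le_induction with
    | base =>
      simp only [rowSum_succ, rowSum_toggle_of_le _ le_rfl, toggle_self]
      have := h.lo_le t i₀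
      push_cast
      omega
    | succ N hN ih =>
      rw [rowSum_succ _ _ (N + 1), rowSum_succ _ _ (N + 1), rowSum_succ _ _ (N + 1),
        rowSum_succ _ _ (N + 1), toggle_of_gt (by omega)]
      have h3 := h.lo_le t (N + 1)
      have h5 := h.le_hi t (N + 1)
      have h4 := hi_succ_add_lo g t N
      push_cast
      omega
  obtain ⟨N, rfl⟩ : ∃ N, n = N + 1 := ⟨n - 1, by omega⟩
  have h2 := key N (by omega)
  -- Row `N + 1 = n` is empty, so the boundary term of the telescoping sum vanishes.
  have h3 : lo g t N = g t N := by
    simp [lo, h.eq_zero_of_le (s := t + 1 + 1) (le_refl (N + 1))]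
  rw [h3] at h2
  simpa using h2

end Toggle

/-! ### First failures and the sign-reversing involution -/

/-- Failure of the dominance condition at row `i` and letters `t`, `t + 1`. -/
def Fails (n : ℕ) (mu : ℕ → ℕ) (g : ℕ → ℕ → ℕ) (i t : ℕ) : Prop :=
  t + 1 < n ∧ shapeAt mu g i t < shapeAt mu g (i + 1) (t + 1)

/-- The first failure in the reading order. -/
structure FirstFail (n : ℕ) (mu : ℕ → ℕ) (g : ℕ → ℕ → ℕ) (i t : ℕ) : Prop where
  fails : Fails n mu g i t
  before : ∀ i' < i, ∀ t', ¬ Fails n mu g i' t'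
  above : ∀ t', t < t' → ¬ Fails n mu g i t'

/-- No failure: the words read off the rows keep `mu` a partition. -/
def Dominant (n : ℕ) (mu : ℕ → ℕ) (g : ℕ → ℕ → ℕ) : Prop := ∀ i t, ¬ Fails n mu g i t

/-- Take the least row and then the largest letter: reading a row from right to left meets larger
letters first. -/
theorem exists_firstFail {n : ℕ} {mu : ℕ → ℕ} {g : ℕ → ℕ → ℕ} (h : ¬ Dominant n mu g) :
    ∃ p : ℕ × ℕ, FirstFail n mu g p.1 p.2 := by
  classical
  have h1 : ∃ i, ∃ t, Fails n mu g i t := by simpa [Dominant] using h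
  obtain ⟨t, ht⟩ := Nat.find_spec h1
  have h2 : ∀ t, Fails n mu g (Nat.find h1) t → t ≤ n := fun t ht => by have := ht.1; omega
  refine ⟨(Nat.find h1, Nat.findGreatest (fun t => Fails n mu g (Nat.find h1) t) n), ?_, ?_, ?_⟩
  · exact Nat.findGreatest_spec (P := fun t => Fails n mu g (Nat.find h1) t) (h2 t ht) ht
  · intro i' hi' t' ht'
    exact Nat.find_min h1 hi' ⟨t', ht'⟩
  · intro t' ht' hf
    exact Nat.findGreatest_is_greatest ht' (h2 t' hf) hf

theorem FirstFail.unique {n : ℕ} {mu : ℕ → ℕ} {g : ℕ → ℕ → ℕ} {i t i' t' : ℕ}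
    (h : FirstFail n mu g i t) (h' : FirstFail n mu g i' t') : i = i' ∧ t = t' := by
  have h1 : i = i' := by
    rcases lt_trichotomy i i' with h1 | h1 | h1
    · exact (h'.before i h1 t h.fails).elim
    · exact h1
    · exact (h.before i' h1 t' h'.fails).elim
  subst h1
  refine ⟨rfl, ?_⟩
  rcases lt_trichotomy t t' with h1 | h1 | h1
  · exact (h.above _ h1 h'.fails).elim
  · exact h1
  · exact (h'.above _ h1 h.fails).elim

/-- The column at which the reading of row `i` first fails. -/
def failCol (mu : ℕ → ℕ) (g : ℕ → ℕ → ℕ) (i t : ℕ) : ℕ :=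
  g (t + 1 + 1) i + shapeAt mu g i (t + 1) - shapeAt mu g i t - 1

/-- The sign-reversing involution on the patterns that are not dominant. -/
def failToggle (mu : ℕ → ℕ) (i t : ℕ) (g : ℕ → ℕ → ℕ) : ℕ → ℕ → ℕ :=
  toggle t i (failCol mu g i t) g

section

variable {n : ℕ} {mu nu : ℕ → ℕ} {g : ℕ → ℕ → ℕ} {i t : ℕ}

theorem failCol_failToggle : failCol mu (failToggle mu i t g) i t = failCol mu g i t := by
  rw [failCol, failToggle, shapeAt_toggle_of_le _ le_rfl, shapeAt_toggle_of_le _ le_rfl,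
    toggle_of_ne (by omega)]
  rfl

/-- This form uses the content of the rows above `i` and two levels of row `i`; a toggle in row `i`
changes only level `t + 1` among these data. -/
theorem IsGT.fails_iff (h : IsGT n nu g) (ht : t + 1 < n) : Fails n mu g i t ↔
    g (t + 1) i + shapeAt mu g i t + 1 ≤ g (t + 1 + 1) i + shapeAt mu g i (t + 1) := by
  have h1 := h.shapeAt_succ mu i (t + 1)
  simp only [Fails, ht, true_and]
  omega

theorem IsGT.shapeAt_antitone_of_not_fails (h : IsGT n nu g) (hmu : Antitone mu)
    (hb : ∀ i' < i, ∀ t', ¬ Fails n mu g i' t') (ht : t + 1 < n) :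
    shapeAt mu g i (t + 1) ≤ shapeAt mu g i t := by
  cases i with
  | zero => simpa [shapeAt] using hmu (Nat.le_succ t)
  | succ i =>
    have h1 := hb i (by omega) t
    simp only [Fails, ht, true_and, not_lt] at h1
    exact h1.trans (h.shapeAt_le_succ mu i t)

theorem FirstFail.failCol_add (hf : FirstFail n mu g i t) (h : IsGT n nu g) :
    failCol mu g i t + shapeAt mu g i t + 1 = g (t + 1 + 1) i + shapeAt mu g i (t + 1) := by
  have h1 := (h.fails_iff hf.fails.1).mp hf.fails
  unfold failCol
  omega

theorem FirstFail.le_failCol (hf : FirstFail n mu g i t) (h : IsGT n nu g) :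
    g (t + 1) i ≤ failCol mu g i t := by
  have h1 := (h.fails_iff hf.fails.1).mp hf.fails
  have h2 := hf.failCol_add h
  omega

theorem FirstFail.failCol_lt (hf : FirstFail n mu g i t) (h : IsGT n nu g) (hmu : Antitone mu) :
    failCol mu g i t < g (t + 1 + 1) i := by
  have h2 := hf.failCol_add h
  have h3 := h.shapeAt_antitone_of_not_fails hmu hf.before hf.fails.1
  omega

/-- In row `i`, a letter `t + 1` in a column at or beyond `g t (i - 1)` lies below a letter `t`.
Absence of failure in row `i - 1` leaves enough slack for all of these, so the failing column lies
further left. -/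
theorem FirstFail.failCol_le (hf : FirstFail n mu g i t) (h : IsGT n nu g) (hmu : Antitone mu) :
    failCol mu g i t ≤ hi g t i := by
  have h1 := hf.failCol_lt h hmu
  cases i with
  | zero => exact h1.le
  | succ i =>
    refine le_min h1.le ?_
    have h2 := hf.failCol_add h
    have h3 := hf.before i (by omega) t
    simp only [Fails, hf.fails.1, true_and, not_lt] at h3
    have h4 := h.shapeAt_succ mu i t
    have h5 := h.inter (t + 1) i
    omega

theorem FirstFail.isGT (hf : FirstFail n mu g i t) (h : IsGT n nu g) (hmu : Antitone mu) :
    IsGT n nu (failToggle mu i t g) :=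
  h.toggle hf.fails.1 (hf.le_failCol h) (hf.failCol_le h hmu)

/-- What is read before the failure is untouched: the rows above, and the levels beyond `t + 1` in
row `i`. Since `lo` is at most the old entry, the reflected entry is still at most the failing
column, so the same failure occurs. -/
theorem FirstFail.failToggle (hf : FirstFail n mu g i t) (h : IsGT n nu g) (hmu : Antitone mu) :
    FirstFail n mu (failToggle mu i t g) i t := by
  have h' := hf.isGT h hmu
  have hle : ∀ i' ≤ i, ∀ s, shapeAt mu (CodeLR.failToggle mu i t g) i' s = shapeAt mu g i' s :=
    fun i' hi' s => shapeAt_toggle_of_le mu hi' s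
  refine ⟨?_, ?_, ?_⟩
  · rw [h'.fails_iff hf.fails.1, hle i le_rfl, hle i le_rfl]
    have h1 := hf.failCol_add h
    have h2 := h.lo_le t i
    rw [CodeLR.failToggle, toggle_self, toggle_of_ne (by omega)]
    omega
  · intro i' hi' t' ht'
    refine hf.before i' hi' t' ⟨ht'.1, ?_⟩
    rw [← hle i' (by omega), ← hle (i' + 1) (by omega)]
    exact ht'.2
  · intro t' ht' hf'
    refine hf.above t' ht' ?_
    have ht'' := hf'.1
    rw [h'.fails_iff ht'', hle i le_rfl, hle i le_rfl, CodeLR.failToggle,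
      toggle_of_ne (by omega), toggle_of_ne (by omega)] at hf'
    rwa [h.fails_iff ht'']

theorem FirstFail.failToggle_failToggle (hf : FirstFail n mu g i t) (h : IsGT n nu g) :
    CodeLR.failToggle mu i t (CodeLR.failToggle mu i t g) = g := by
  rw [CodeLR.failToggle, failCol_failToggle]
  exact h.toggle_toggle (hf.le_failCol h)

theorem shapeAt_toggle_of_ne {c s : ℕ} (hs : s ≠ t) (hs' : s ≠ t + 1) (j : ℕ) :
    shapeAt mu (toggle t i c g) j s = shapeAt mu g j s := by
  simp [shapeAt, rowSum_toggle_of_ne hs', rowSum_toggle_of_ne (show s + 1 ≠ t + 1 by omega)]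

/-- Counted with `mu`, the part read up to the failure has exactly one more `t + 1` than `t`; in the
unread part the two numbers are exchanged. Since `rho` drops by one from `t` to `t + 1`, the
exponents shifted by `rho` are swapped. -/
theorem FirstFail.shapeAt_failToggle (hf : FirstFail n mu g i t) (h : IsGT n nu g)
    (hmu : Antitone mu) :
    shapeAt mu (CodeLR.failToggle mu i t g) n t + 1 = shapeAt mu g n (t + 1) ∧
    shapeAt mu (CodeLR.failToggle mu i t g) n (t + 1) = shapeAt mu g n t + 1 := by
  have h' := hf.isGT h hmu
  have hi : i < n := by
    by_contra hi
    have h1 := hf.failCol_lt h hmu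
    rw [h.eq_zero_of_le (by omega)] at h1
    omega
  have h1 := h.rowSum_toggle hf.fails.1 (hf.le_failCol h) hi (K := mu (t + 1) - mu t - 1) (by
    have h1 := hf.failCol_add h
    have h2 := h.shapeAt_add mu i t
    have h3 := h.shapeAt_add mu i (t + 1)
    omega)
  have h2 := h.shapeAt_add mu n t
  have h3 := h.shapeAt_add mu n (t + 1)
  have h4 := h'.shapeAt_add mu n t
  have h5 := h'.shapeAt_add mu n (t + 1)
  simp only [CodeLR.failToggle] at h4 h5 ⊢
  rw [rowSum_toggle_of_ne (s := t) (by omega)] at h4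
  rw [rowSum_toggle_of_ne (s := t + 1 + 1) (by omega)] at h5
  constructor <;> omega

theorem IsGT.shapeAt_toggle_zero (h : IsGT n nu g) (ht : t + 1 < n) :
    shapeAt mu (CodeLR.toggle t 0 (g (t + 1 + 1) 0) g) n t + mu (t + 1) =
      shapeAt mu g n (t + 1) + mu t ∧
    shapeAt mu (CodeLR.toggle t 0 (g (t + 1 + 1) 0) g) n (t + 1) + mu t =
      shapeAt mu g n t + mu (t + 1) := by
  have h' := h.toggle ht (i₀ := 0) (h.mono (t + 1) 0) le_rfl
  have h1 := h.rowSum_toggle ht (i₀ := 0) (h.mono (t + 1) 0) (by omega) (K := 0) (by simp)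
  have h2 := h.shapeAt_add mu n t
  have h3 := h.shapeAt_add mu n (t + 1)
  have h4 := h'.shapeAt_add mu n t
  have h5 := h'.shapeAt_add mu n (t + 1)
  rw [rowSum_toggle_of_ne (s := t) (by omega)] at h4
  rw [rowSum_toggle_of_ne (s := t + 1 + 1) (by omega)] at h5
  constructor <;> omega

end

/-! ### Alternants -/

open MvPolynomial

section Alternant

variable {n : ℕ}

/-- The monomial with exponents `a`. -/
noncomputable def mon (a : Fin n → ℕ) : MvPolynomial (Fin n) ℂ := ∏ i, X i ^ a i

/-- The alternant `det (x_i ^ a_j)`. -/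
noncomputable def alt (a : Fin n → ℕ) : MvPolynomial (Fin n) ℂ :=
  (Matrix.of fun i j : Fin n => (X i : MvPolynomial (Fin n) ℂ) ^ a j).det

theorem rename_mon (w : Equiv.Perm (Fin n)) (a : Fin n → ℕ) :
    rename w (mon a) = mon (a ∘ w.symm) := by
  simp only [mon, map_prod, map_pow, rename_X, Function.comp]
  exact Fintype.prod_equiv w _ _ fun i => by simp

theorem mon_add (a b : Fin n → ℕ) : mon (a + b) = mon a * mon b := by
  simp [mon, pow_add, Finset.prod_mul_distrib]

theorem mon_eq_monomial (a : Fin n → ℕ) : mon a = monomial (Finsupp.equivFunOnFinite.symm a) 1 := by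
  rw [monomial_eq, Finsupp.prod_fintype _ _ (by simp)]
  simp [mon]

theorem alt_eq_sum (a : Fin n → ℕ) :
    alt a = ∑ w : Equiv.Perm (Fin n), Equiv.Perm.sign w • rename w (mon a) := by
  simp [alt, Matrix.det_apply, mon, map_prod]

theorem alt_comp_swap (a : Fin n → ℕ) {i j : Fin n} (h : i ≠ j) :
    alt (a ∘ Equiv.swap i j) = -alt a := by
  have h1 := Matrix.det_permute' (Equiv.swap i j)
    (Matrix.of fun i j : Fin n => (X i : MvPolynomial (Fin n) ℂ) ^ a j)
  rw [Equiv.Perm.sign_swap h] at h1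
  simpa [alt, Matrix.submatrix] using h1

/-- A strictly decreasing sequence has no other strictly decreasing rearrangement, so only the
identity permutation can contribute. -/
theorem coeff_alt {a b : Fin n → ℕ} (ha : StrictAnti a) (hb : StrictAnti b) :
    coeff (Finsupp.equivFunOnFinite.symm b) (alt a) = if a = b then 1 else 0 := by
  have key : ∀ w : Equiv.Perm (Fin n),
      coeff (Finsupp.equivFunOnFinite.symm b) (Equiv.Perm.sign w • rename w (mon a)) =
      if w = 1 then (if a = b then 1 else 0) else 0 := by
    intro w
    rw [coeff_smul, rename_mon, mon_eq_monomial, coeff_monomial]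
    simp only [EmbeddingLike.apply_eq_iff_eq]
    by_cases hw : w = 1
    · subst hw
      have : a ∘ (Equiv.symm (1 : Equiv.Perm (Fin n))) = a := rfl
      simp [this]
    · rw [if_neg hw, if_neg, smul_zero]
      intro h
      have h1 : Set.range a = Set.range b := by
        rw [← h, w.symm.surjective.range_comp]
      have h2 : a = b := (StrictAnti.range_inj ha hb).mp h1
      refine hw (Equiv.ext fun i => ?_)
      have h3 := congrFun h (w i)
      rw [← h2] at h3
      simpa using ha.injective h3.symm
  rw [alt_eq_sum, coeff_sum, Finset.sum_congr rfl fun w _ => key w]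
  simp

/-- A symmetric factor passes inside every term of the antisymmetrization. -/
theorem mul_alt {f : MvPolynomial (Fin n) ℂ} (hf : ∀ w : Equiv.Perm (Fin n), rename w f = f)
    (a : Fin n → ℕ) :
    f * alt a = ∑ w : Equiv.Perm (Fin n), Equiv.Perm.sign w • rename w (f * mon a) := by
  rw [alt_eq_sum, Finset.mul_sum]
  exact Finset.sum_congr rfl fun w _ => by rw [map_mul, hf, mul_smul_comm]

/-- The exponents `n - 1, …, 1, 0`. -/
def rho (n : ℕ) (t : Fin n) : ℕ := n - 1 - t

theorem strictAnti_add_rho {a : ℕ → ℕ} (ha : Antitone a) :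
    StrictAnti fun t : Fin n => a t + rho n t := by
  intro s t hst
  have h1 := ha (show (s : ℕ) ≤ t from hst.le)
  have h2 : (s : ℕ) < t := hst
  have := t.2
  simp only [rho]
  omega

theorem strictAnti_rho : StrictAnti (rho n) := by
  simpa using strictAnti_add_rho (n := n) (a := fun _ => 0) antitone_const

theorem alt_rho_ne_zero : alt (rho n) ≠ 0 := fun h => by
  have h1 := coeff_alt strictAnti_rho (strictAnti_rho (n := n))
  simp [h] at h1

/-- A polynomial that is fixed by the adjacent transpositions is symmetric. -/
theorem rename_eq_self {f : MvPolynomial (Fin n) ℂ}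
    (hf : ∀ t (ht : t + 1 < n),
      rename (Equiv.swap (⟨t, by omega⟩ : Fin n) ⟨t + 1, ht⟩) f = f)
    (w : Equiv.Perm (Fin n)) : rename w f = f := by
  cases n with
  | zero =>
    rw [Subsingleton.elim w 1]
    exact rename_id_apply f
  | succ n =>
    have hw : w ∈ Submonoid.closure
        (Set.range fun i : Fin n => Equiv.swap i.castSucc i.succ) := by
      rw [Equiv.Perm.mclosure_swap_castSucc_succ]
      trivial
    induction hw using Submonoid.closure_induction with
    | mem x hx =>
      obtain ⟨i, rfl⟩ := hx
      exact hf i (by omega)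
    | one => exact rename_id_apply f
    | mul x y _ _ hx hy =>
      rw [Equiv.Perm.coe_mul, ← rename_rename, hy, hx]

end Alternant

/-! ### Schur polynomials times alternants -/

section SchurPoly

variable {n : ℕ}

/-- The Schur polynomial in `n` variables, as a sum over patterns. -/
noncomputable def schurPoly (n : ℕ) (nu : ℕ → ℕ) : MvPolynomial (Fin n) ℂ :=
  ∑ g ∈ gts n nu, mon fun t : Fin n => shapeAt 0 g n t

theorem shapeAt_eq_add (mu : ℕ → ℕ) (g : ℕ → ℕ → ℕ) (i t : ℕ) :
    shapeAt mu g i t = mu t + shapeAt 0 g i t := by simp [shapeAt]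

theorem eq_comp_swap {a b : ℕ → ℕ} {t : ℕ} (ht : t + 1 < n) (h1 : b t = a (t + 1))
    (h2 : b (t + 1) = a t) (h3 : ∀ s, s ≠ t → s ≠ t + 1 → b s = a s) :
    (fun s : Fin n => b s) =
      (fun s : Fin n => a s) ∘ Equiv.swap (⟨t, by omega⟩ : Fin n) ⟨t + 1, ht⟩ := by
  funext s
  simp only [Function.comp, Equiv.swap_apply_def]
  split_ifs with h h'
  · subst h; exact h1
  · subst h'; exact h2
  · exact h3 s (fun e => h (Fin.ext e)) (fun e => h' (Fin.ext e))

/-- The uncut toggle, with `i₀ = 0` and `c` the full upper bound in row `0`, exchanges the numbers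
of letters `t` and `t + 1`. -/
theorem rename_schurPoly (nu : ℕ → ℕ) (w : Equiv.Perm (Fin n)) :
    rename w (schurPoly n nu) = schurPoly n nu := by
  refine rename_eq_self (fun t ht => ?_) w
  rw [schurPoly, map_sum]
  have hi : ∀ g ∈ gts n nu, toggle t 0 (g (t + 1 + 1) 0) g ∈ gts n nu := fun g hg => by
    rw [mem_gts] at hg ⊢
    exact hg.toggle ht (hg.mono (t + 1) 0) le_rfl
  have hii : ∀ g ∈ gts n nu, toggle t 0 (toggle t 0 (g (t + 1 + 1) 0) g (t + 1 + 1) 0)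
      (toggle t 0 (g (t + 1 + 1) 0) g) = g := fun g hg => by
    rw [mem_gts] at hg
    rw [toggle_of_ne (by omega)]
    exact hg.toggle_toggle (hg.mono (t + 1) 0)
  refine Finset.sum_nbij' (fun g => toggle t 0 (g (t + 1 + 1) 0) g)
    (fun g => toggle t 0 (g (t + 1 + 1) 0) g) hi hi hii hii fun g hg => ?_
  rw [rename_mon]
  congr 1
  rw [mem_gts] at hg
  have h1 := hg.shapeAt_toggle_zero (mu := 0) ht
  simp only [Pi.zero_apply, add_zero] at h1
  rw [Equiv.symm_swap]
  exact (eq_comp_swap ht h1.1 h1.2 fun s hs hs' => shapeAt_toggle_of_ne hs hs' n).symm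

theorem schurPoly_mul_alt_eq_sum (nu : ℕ → ℕ) (a : Fin n → ℕ) :
    schurPoly n nu * alt a = ∑ g ∈ gts n nu, alt fun t => shapeAt 0 g n t + a t := by
  rw [mul_alt (rename_schurPoly nu)]
  simp only [schurPoly, Finset.sum_mul, map_sum, Finset.smul_sum, ← mon_add]
  rw [Finset.sum_comm]
  refine Finset.sum_congr rfl fun g _ => ?_
  rw [alt_eq_sum]
  rfl

open Classical in
theorem sum_alt_not_dominant {mu : ℕ → ℕ} (hmu : Antitone mu) (nu : ℕ → ℕ) :
    ∑ g ∈ (gts n nu).filter (fun g => ¬ Dominant n mu g),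
      alt (fun t : Fin n => shapeAt mu g n t + rho n t) = 0 := by
  have hex : ∀ g ∈ (gts n nu).filter (fun g => ¬ Dominant n mu g),
      ∃ p : ℕ × ℕ, FirstFail n mu g p.1 p.2 := fun g hg =>
    exists_firstFail (Finset.mem_filter.mp hg).2
  have hgt : ∀ g ∈ (gts n nu).filter (fun g => ¬ Dominant n mu g), IsGT n nu g := fun g hg =>
    mem_gts.mp (Finset.mem_filter.mp hg).1
  choose! p hp using hex
  have hpt : ∀ g ∈ (gts n nu).filter (fun g => ¬ Dominant n mu g),
      failToggle mu (p g).1 (p g).2 g ∈ (gts n nu).filter (fun g => ¬ Dominant n mu g) :=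
    fun g hg => Finset.mem_filter.mpr ⟨mem_gts.mpr ((hp g hg).isGT (hgt g hg) hmu),
      fun hd => hd _ _ ((hp g hg).failToggle (hgt g hg) hmu).fails⟩
  have hsum : ∀ g ∈ (gts n nu).filter (fun g => ¬ Dominant n mu g),
      alt (fun t : Fin n => shapeAt mu g n t + rho n t) +
      alt (fun t : Fin n => shapeAt mu (failToggle mu (p g).1 (p g).2 g) n t + rho n t) = 0 := by
    intro g hg
    have ht := (hp g hg).fails.1
    obtain ⟨h1, h2⟩ := (hp g hg).shapeAt_failToggle (hgt g hg) hmu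
    have h3 := eq_comp_swap (n := n) ht
      (a := fun t => shapeAt mu g n t + (n - 1 - t))
      (b := fun t => shapeAt mu (failToggle mu (p g).1 (p g).2 g) n t + (n - 1 - t))
      (by omega) (by omega)
      (fun s hs hs' => by
        rw [failToggle, shapeAt_toggle_of_ne hs hs'])
    have h4 := alt_comp_swap (fun t : Fin n => shapeAt mu g n t + (n - 1 - t))
      (i := (⟨(p g).2, by omega⟩ : Fin n)) (j := ⟨(p g).2 + 1, ht⟩) (by simp [Fin.ext_iff])
    rw [← h3] at h4
    simp only [rho]
    rw [h4, add_neg_cancel]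
  refine Finset.sum_involution (fun g _ => failToggle mu (p g).1 (p g).2 g) hsum ?_ hpt ?_
  · intro g hg hne heq
    have h1 := hsum g hg
    -- The alternant of a fixed pattern is its own negative, hence zero; fixed points need no
    -- separate exclusion.
    rw [heq, ← two_mul] at h1
    exact hne ((mul_eq_zero.mp h1).resolve_left two_ne_zero)
  · intro g hg
    obtain ⟨h1, h2⟩ := (hp _ (hpt g hg)).unique ((hp g hg).failToggle (hgt g hg) hmu)
    rw [h1, h2]
    exact (hp g hg).failToggle_failToggle (hgt g hg)

open Classical in
theorem schurPoly_mul_alt {mu : ℕ → ℕ} (hmu : Antitone mu) (nu : ℕ → ℕ) :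
    schurPoly n nu * alt (fun t : Fin n => mu t + rho n t) =
      ∑ g ∈ (gts n nu).filter (Dominant n mu),
        alt (fun t : Fin n => shapeAt mu g n t + rho n t) := by
  have h1 := Finset.sum_filter_add_sum_filter_not (gts n nu) (Dominant n mu)
    fun g => alt (fun t : Fin n => shapeAt mu g n t + rho n t)
  rw [sum_alt_not_dominant hmu, add_zero] at h1
  rw [h1, schurPoly_mul_alt_eq_sum]
  refine Finset.sum_congr rfl fun g _ => ?_
  congr 1
  funext t
  have := shapeAt_eq_add mu g n t
  omega

/-- The pattern of the tableau with all entries in row `i` equal to `i`. -/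
def highest (nu : ℕ → ℕ) (s i : ℕ) : ℕ := if i < s then nu i else 0

theorem isGT_highest {nu : ℕ → ℕ} (hnu : Antitone nu) (h0 : nu n = 0) :
    IsGT n nu (highest nu) where
  zero i := by simp [highest]
  mono s i := by simp only [highest]; split_ifs <;> omega
  inter s i := by
    have := hnu (Nat.le_succ i)
    simp only [highest]; split_ifs <;> omega
  top s hs i := by
    simp only [highest]
    split_ifs with h
    · rfl
    · have := hnu (show n ≤ i by omega)
      omega

theorem rowSum_highest (nu : ℕ → ℕ) (t i : ℕ) :
    rowSum (highest nu) (t + 1) i = rowSum (highest nu) t i + if t < i then nu t else 0 := by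
  induction i with
  | zero => simp
  | succ i ih =>
    rw [rowSum_succ, rowSum_succ, ih]
    simp only [highest]
    rcases lt_trichotomy t i with h | rfl | h <;> split_ifs <;> omega

theorem shapeAt_highest (nu : ℕ → ℕ) (i t : ℕ) :
    shapeAt 0 (highest nu) i t = if t < i then nu t else 0 := by
  simp [shapeAt, rowSum_highest]

/-- If the rows above row `i` are constant, no letter from `i` on has been read yet. A letter larger
than `i` in row `i` would then outnumber its predecessor, so row `i` is constant as well. -/
theorem dominant_zero_iff {nu : ℕ → ℕ} {g : ℕ → ℕ → ℕ} (hg : IsGT n nu g) :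
    Dominant n 0 g ↔ g = highest nu := by
  have hnu := hg.shape_antitone
  constructor
  · intro hd
    have key : ∀ i, ∀ s, g s i = highest nu s i := by
      intro i
      induction i using Nat.strong_induction_on with
      | _ i ih =>
        have hr : ∀ s, rowSum g s i = rowSum (highest nu) s i := fun s =>
          Finset.sum_congr rfl fun j hj => ih j (by simpa using hj) s
        have hsh : ∀ t, shapeAt 0 g i t = if t < i then nu t else 0 := fun t => by
          rw [← shapeAt_highest]
          simp [shapeAt, hr]
        have hstep : ∀ t, i ≤ t → t + 1 < n → g (t + 1 + 1) i = g (t + 1) i := by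
          intro t hit ht
          have h1 := hd i t
          rw [hg.fails_iff ht, hsh, hsh, if_neg (by omega), if_neg (by omega)] at h1
          have := hg.mono (t + 1) i
          omega
        intro s
        rcases le_or_gt s i with hs | hs
        · rw [hg.eq_zero hs, highest, if_neg (by omega)]
        rw [highest, if_pos hs]
        rcases le_or_gt n s with hns | hns
        · exact hg.top s hns i
        · have h2 : ∀ s', s ≤ s' → s' ≤ n → g s' i = g s i := by
            intro s' hs'
            induction s', hs' using Nat.le_induction with
            | base => intro _; rfl
            | succ m hm ihm =>
              intro hmn
              obtain ⟨t, rfl⟩ : ∃ t, m = t + 1 := ⟨m - 1, by omega⟩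
              rw [hstep t (by omega) (by omega), ihm (by omega)]
          rw [← h2 n hns.le le_rfl, hg.top n le_rfl]
    funext s i
    exact key i s
  · rintro rfl i t ⟨ht, h⟩
    rw [shapeAt_highest, shapeAt_highest] at h
    have := hnu (show t ≤ t + 1 by omega)
    split_ifs at h <;> omega

/-- The bialternant formula: the case `mu = 0` of `schurPoly_mul_alt`, where one term survives. -/
theorem schurPoly_mul_alt_rho {nu : ℕ → ℕ} (hnu : Antitone nu) (h0 : nu n = 0) :
    schurPoly n nu * alt (rho n) = alt fun t : Fin n => nu t + rho n t := by
  classical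
  have h1 := schurPoly_mul_alt (n := n) (mu := 0) antitone_const nu
  have h2 : (gts n nu).filter (Dominant n 0) = {highest nu} := by
    ext g
    simp only [Finset.mem_filter, mem_gts, Finset.mem_singleton]
    constructor
    · rintro ⟨hg, hd⟩
      exact (dominant_zero_iff hg).mp hd
    · rintro rfl
      have hg := isGT_highest hnu h0
      exact ⟨hg, (dominant_zero_iff hg).mpr rfl⟩
  rw [h2, Finset.sum_singleton] at h1
  simpa [shapeAt_highest] using h1

end SchurPoly

/-! ### Tableaux as patterns; from polynomials to power series -/

theorem lt_card_filter_range_iff {p : ℕ → Prop} [DecidablePred p] {N j : ℕ}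
    (hp : ∀ a b, a ≤ b → b < N → p b → p a) :
    j < ((Finset.range N).filter p).card ↔ j < N ∧ p j := by
  constructor
  · intro h
    by_contra hj
    have h1 : (Finset.range N).filter p ⊆ Finset.range j := fun a ha => by
      simp only [Finset.mem_filter, Finset.mem_range] at ha ⊢
      by_contra haj
      exact hj ⟨by omega, hp j a (by omega) ha.1 ha.2⟩
    have h2 := Finset.card_le_card h1
    rw [Finset.card_range] at h2
    omega
  · rintro ⟨h1, h2⟩
    have h3 : Finset.range (j + 1) ⊆ (Finset.range N).filter p := fun a ha => by
      simp only [Finset.mem_filter, Finset.mem_range] at ha ⊢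
      exact ⟨by omega, hp a j (by omega) h1 h2⟩
    have h4 := Finset.card_le_card h3
    rw [Finset.card_range] at h4
    omega

section Levels

variable {lam : YoungDiagram} {n : ℕ}

/-- The pattern of a semistandard tableau. -/
def levels (T : SemistandardYoungTableau lam) (s i : ℕ) : ℕ :=
  ((Finset.range (lam.rowLen i)).filter fun j => T i j < s).card

theorem lt_levels_iff (T : SemistandardYoungTableau lam) (s i j : ℕ) :
    j < levels T s i ↔ j < lam.rowLen i ∧ T i j < s :=
  lt_card_filter_range_iff fun _ _ hab hb hT =>
    (T.row_weak_of_le hab (YoungDiagram.mem_iff_lt_rowLen.mpr hb)).trans_lt hT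

theorem isGT_levels (T : SemistandardYoungTableau lam)
    (hT : ∀ i j, j < lam.rowLen i → T i j < n) : IsGT n lam.rowLen (levels T) where
  zero i := by simp [levels]
  mono s i := le_of_forall_lt fun j hj => by
    rw [lt_levels_iff] at hj ⊢
    exact ⟨hj.1, by omega⟩
  inter s i := le_of_forall_lt fun j hj => by
    rw [lt_levels_iff] at hj ⊢
    have h1 := T.col_strict (show i < i + 1 by omega) (YoungDiagram.mem_iff_lt_rowLen.mpr hj.1)
    have h2 := lam.rowLen_anti i (i + 1) (by omega)
    exact ⟨by omega, by omega⟩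
  top s hs i := by
    refine eq_of_forall_lt_iff fun j => ?_
    rw [lt_levels_iff]
    exact ⟨fun h => h.1, fun h => ⟨h, (hT i j h).trans_le hs⟩⟩

theorem sum_cells {M : Type*} [AddCommMonoid M] (h : lam.rowLen n = 0) (f : ℕ × ℕ → M) :
    ∑ b ∈ lam.cells, f b =
      ∑ i ∈ Finset.range n, ∑ j ∈ Finset.range (lam.rowLen i), f (i, j) := by
  refine Finset.sum_finset_product _ _ _ fun p => ?_
  rw [YoungDiagram.mem_cells, Finset.mem_range, Finset.mem_range, ← YoungDiagram.mem_iff_lt_rowLen]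
  refine ⟨fun hp => ⟨?_, hp⟩, fun hp => hp.2⟩
  by_contra hn
  have h1 := lam.rowLen_anti n p.1 (by omega)
  have h2 := YoungDiagram.mem_iff_lt_rowLen.mp hp
  omega

theorem content_eq_shapeAt (T : SemistandardYoungTableau lam)
    (h : IsGT n lam.rowLen (levels T)) (t : ℕ) : content T t = shapeAt 0 (levels T) n t := by
  have h1 := h.shapeAt_add 0 n t
  rw [content, Finset.sum_apply', sum_cells (n := n) (by
    rw [← h.top n le_rfl]; exact h.eq_zero le_rfl)]
  suffices h2 : (∑ i ∈ Finset.range n, ∑ j ∈ Finset.range (lam.rowLen i),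
      (Finsupp.single (T i j) 1 : ℕ →₀ ℕ) t) + rowSum (levels T) t n =
      rowSum (levels T) (t + 1) n by
    simp only [Pi.zero_apply] at h1
    dsimp only
    omega
  rw [rowSum, rowSum, ← Finset.sum_add_distrib]
  refine Finset.sum_congr rfl fun i _ => ?_
  simp only [levels, Finset.card_filter, ← Finset.sum_add_distrib, Finsupp.single_apply]
  refine Finset.sum_congr rfl fun j _ => ?_
  split_ifs <;> omega

theorem IsGT.shapeAt_zero_of_le {nu : ℕ → ℕ} {g : ℕ → ℕ → ℕ} (h : IsGT n nu g) {t : ℕ}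
    (ht : n ≤ t) (i : ℕ) : shapeAt 0 g i t = 0 := by
  simp [shapeAt, rowSum, h.top t ht, h.top (t + 1) (by omega)]

theorem lt_of_content (T : SemistandardYoungTableau lam) (hT : ∀ t, n ≤ t → content T t = 0)
    (i j : ℕ) (hj : j < lam.rowLen i) : T i j < n := by
  by_contra hn
  have h1 := hT (T i j) (by omega)
  rw [content, Finset.sum_apply', Finset.sum_eq_zero_iff] at h1
  have h2 := h1 (i, j) (by rwa [YoungDiagram.mem_cells, YoungDiagram.mem_iff_lt_rowLen])
  simp at h2

theorem levels_injective : Function.Injective (levels (lam := lam)) := by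
  intro T T' h
  refine SemistandardYoungTableau.ext fun i j => ?_
  by_cases hj : j < lam.rowLen i
  · refine eq_of_forall_gt_iff fun s => ?_
    have h1 := lt_levels_iff T s i j
    have h2 := lt_levels_iff T' s i j
    rw [h] at h1
    simp only [hj, true_and] at h1 h2
    exact h1.symm.trans h2
  · have h1 : (i, j) ∉ lam := fun h => hj (YoungDiagram.mem_iff_lt_rowLen.mp h)
    rw [T.zeros h1, T'.zeros h1]

-- The cell `(i, j)` gets the least `s` with `j < g (s + 1) i`. Rows increase weakly by
-- construction, and interlacing gives strict columns.
open Classical in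
theorem exists_levels_eq {g : ℕ → ℕ → ℕ} (h : IsGT n lam.rowLen g) :
    ∃ T : SemistandardYoungTableau lam, levels T = g := by
  have hex : ∀ i j, j < lam.rowLen i → ∃ s, j < g (s + 1) i := fun i j hj =>
    ⟨n, by rwa [h.top (n + 1) (by omega)]⟩
  let T : ℕ → ℕ → ℕ := fun i j => if hj : j < lam.rowLen i then Nat.find (hex i j hj) else 0
  have hT : ∀ s i j, j < lam.rowLen i → (T i j < s ↔ j < g s i) := by
    intro s i j hj
    simp only [T, dif_pos hj, Nat.find_lt_iff]
    constructor
    · rintro ⟨m, hm, hjm⟩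
      exact hjm.trans_le (h.monotone i hm)
    · intro hs
      cases s with
      | zero => rw [h.zero] at hs; omega
      | succ s => exact ⟨s, by omega, hs⟩
  refine ⟨⟨T, ?_, ?_, ?_⟩, ?_⟩
  · intro i j1 j2 hj hc
    have h2 := YoungDiagram.mem_iff_lt_rowLen.mp hc
    have h3 := (hT (T i j2 + 1) i j2 h2).mp (by omega)
    have h4 := (hT (T i j2 + 1) i j1 (by omega)).mpr (by omega)
    omega
  · intro i1 i2 j hi hc
    have h2 := YoungDiagram.mem_iff_lt_rowLen.mp hc
    have h1 := lam.rowLen_anti i1 i2 hi.le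
    have h3 := (hT (T i2 j + 1) i2 j h2).mp (by omega)
    -- Interlacing compares adjacent rows only; iterating it reaches row `i2`.
    have h5 : ∀ k s, g (s + 1) (i1 + 1 + k) ≤ g s i1 := by
      intro k
      induction k with
      | zero => exact fun s => h.inter s i1
      | succ k ih => exact fun s =>
          (h.inter s (i1 + 1 + k)).trans ((h.mono s _).trans (ih s))
    have h6 := h5 (i2 - i1 - 1) (T i2 j)
    rw [show i1 + 1 + (i2 - i1 - 1) = i2 by omega] at h6
    exact (hT (T i2 j) i1 j (by omega)).mpr (by omega)
  · intro i j hc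
    exact dif_neg fun hj => hc (YoungDiagram.mem_iff_lt_rowLen.mpr hj)
  · funext s i
    refine eq_of_forall_lt_iff fun j => ?_
    rw [lt_levels_iff]
    constructor
    · rintro ⟨hj, hs⟩
      exact (hT s i j hj).mp hs
    · intro hj
      have h1 : j < lam.rowLen i := hj.trans_le (h.le_shape s i)
      exact ⟨h1, (hT s i j h1).mpr hj⟩

open Classical in
theorem card_tableaux (lam : YoungDiagram) {d : ℕ →₀ ℕ} (hd : ∀ t, n ≤ t → d t = 0) :
    Nat.card {T : SemistandardYoungTableau lam // content T = d} =
      ((gts n lam.rowLen).filter fun g => ∀ t, shapeAt 0 g n t = d t).card := by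
  have hGT : ∀ T : SemistandardYoungTableau lam, content T = d →
      IsGT n lam.rowLen (levels T) := fun T hT =>
    isGT_levels T (lt_of_content T fun t ht => by rw [hT, hd t ht])
  rw [← Fintype.card_coe, ← Nat.card_eq_fintype_card]
  refine Nat.card_eq_of_bijective (fun T => ⟨levels T.1, ?_⟩) ⟨?_, ?_⟩
  · rw [Finset.mem_filter, mem_gts]
    refine ⟨hGT T.1 T.2, fun t => ?_⟩
    rw [← content_eq_shapeAt T.1 (hGT T.1 T.2), T.2]
  · intro T T' h
    exact Subtype.ext (levels_injective (congrArg Subtype.val h))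
  · rintro ⟨g, hg⟩
    rw [Finset.mem_filter, mem_gts] at hg
    obtain ⟨T, rfl⟩ := exists_levels_eq hg.1
    refine ⟨⟨T, Finsupp.ext fun t => ?_⟩, rfl⟩
    rw [content_eq_shapeAt T hg.1, hg.2]

/-- A monomial in the first `n` variables only sees tableaux with entries `< n`. No bound on the
number of rows is needed: with more than `n` rows both sides vanish. -/
theorem coeff_rename_schurPoly (lam : YoungDiagram) {d : ℕ →₀ ℕ} (hd : ∀ t, n ≤ t → d t = 0) :
    coeff d (rename Fin.val (schurPoly n lam.rowLen)) = MvPowerSeries.coeff d (schur lam) := by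
  classical
  have h1 : MvPowerSeries.coeff d (schur lam) =
      (Nat.card {T : SemistandardYoungTableau lam // content T = d} : ℂ) := rfl
  rw [h1, card_tableaux lam hd, Finset.card_filter, schurPoly, map_sum, coeff_sum, Nat.cast_sum]
  refine Finset.sum_congr rfl fun g hg => ?_
  rw [mem_gts] at hg
  rw [mon_eq_monomial, rename_monomial, coeff_monomial, Nat.cast_ite, Nat.cast_one, Nat.cast_zero]
  refine if_congr ?_ rfl rfl
  rw [DFunLike.ext_iff]
  refine forall_congr' fun t => ?_
  rcases lt_or_ge t n with ht | ht
  · rw [show t = ((⟨t, ht⟩ : Fin n) : ℕ) from rfl, Finsupp.mapDomain_apply Fin.val_injective]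
    rfl
  · rw [Finsupp.mapDomain_of_notMem_range _ _ (by simp; omega), hg.shapeAt_zero_of_le ht]

theorem coeff_rename_mul_schurPoly (lam lam' : YoungDiagram) {d : ℕ →₀ ℕ}
    (hd : ∀ t, n ≤ t → d t = 0) :
    coeff d (rename Fin.val (schurPoly n lam.rowLen * schurPoly n lam'.rowLen)) =
      MvPowerSeries.coeff d (schur lam * schur lam') := by
  rw [map_mul, coeff_mul, MvPowerSeries.coeff_mul]
  refine Finset.sum_congr rfl fun p hp => ?_
  have h1 : ∀ t, p.1 t + p.2 t = d t := fun t => by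
    rw [← Finset.HasAntidiagonal.mem_antidiagonal.mp hp]; rfl
  rw [coeff_rename_schurPoly, coeff_rename_schurPoly]
  · intro t ht
    have := h1 t
    have := hd t ht
    omega
  · intro t ht
    have := h1 t
    have := hd t ht
    omega

theorem exists_bound (d : ℕ →₀ ℕ) : ∃ n, ∀ m t, n ≤ m → m ≤ t → d t = 0 := by
  refine ⟨d.support.sup id + 1, fun m t hm ht => ?_⟩
  by_contra h
  have := Finset.le_sup (f := id) (Finsupp.mem_support_iff.mpr h)
  simp only [id] at this
  omega

end Levels

/-! ### Linear independence of Schur functions -/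

theorem rowLen_eq_zero {lam : YoungDiagram} {n : ℕ} (h : lam.colLen 0 ≤ n) : lam.rowLen n = 0 := by
  by_contra h0
  have h1 := YoungDiagram.mem_iff_lt_colLen.mp
    (YoungDiagram.mem_iff_lt_rowLen.mpr (Nat.pos_of_ne_zero h0))
  omega

theorem rowLen_injective : Function.Injective YoungDiagram.rowLen := fun a b h =>
  YoungDiagram.ext (Finset.ext fun p => by
    rw [YoungDiagram.mem_cells, YoungDiagram.mem_cells, YoungDiagram.mem_iff_lt_rowLen,
      YoungDiagram.mem_iff_lt_rowLen, h])

theorem antitone_rowLen (lam : YoungDiagram) : Antitone lam.rowLen := fun i j h =>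
  lam.rowLen_anti i j h

/-- Restrict a relation to `n` variables, with `n` at least the number of rows of every shape
involved, and multiply by `alt (rho n)`. The bialternant formula turns it into a relation between
alternants, whose coefficient at `lam + rho` isolates `c lam`. -/
theorem linearIndependent_schur : LinearIndependent ℂ schur := by
  classical
  rw [linearIndependent_iff']
  intro s c hc lam hlam
  let n := s.sup fun lam => lam.colLen 0
  have hn : ∀ l ∈ s, l.rowLen n = 0 := fun l hl =>
    rowLen_eq_zero (Finset.le_sup (f := fun lam : YoungDiagram => lam.colLen 0) hl)
  have h1 : ∑ l ∈ s, c l • schurPoly n l.rowLen = 0 := by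
    refine rename_injective _ Fin.val_injective ?_
    ext d
    rw [map_sum, coeff_sum, map_zero, coeff_zero]
    by_cases hd : ∀ t, n ≤ t → d t = 0
    · simp only [map_smul, coeff_smul, coeff_rename_schurPoly _ hd]
      have h2 := congrArg (MvPowerSeries.coeff d) hc
      simpa using h2
    · refine Finset.sum_eq_zero fun l _ => ?_
      rw [map_smul, coeff_smul, coeff_rename_eq_zero, smul_zero]
      rintro e rfl
      refine (hd fun t ht => ?_).elim
      exact Finsupp.mapDomain_of_notMem_range _ _ (by simp; omega)
  have h2 : ∑ l ∈ s, c l • alt (fun t : Fin n => l.rowLen t + rho n t) = 0 := by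
    rw [← zero_mul (alt (rho n)), ← h1, Finset.sum_mul]
    refine Finset.sum_congr rfl fun l hl => ?_
    rw [smul_mul_assoc, schurPoly_mul_alt_rho (antitone_rowLen l) (hn l hl)]
  have h3 := congrArg
    (coeff (Finsupp.equivFunOnFinite.symm fun t : Fin n => lam.rowLen t + rho n t)) h2
  rw [coeff_sum, coeff_zero] at h3
  rw [← h3]
  simp only [coeff_smul, coeff_alt (strictAnti_add_rho (antitone_rowLen _))
    (strictAnti_add_rho (antitone_rowLen _))]
  rw [Finset.sum_eq_single lam]
  · simp
  · intro l hl hne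
    rw [if_neg, smul_zero]
    intro h
    refine hne (rowLen_injective (funext fun t => ?_))
    rcases lt_or_ge t n with ht | ht
    · have := congrFun h ⟨t, ht⟩
      simpa using this
    · have h4 := l.rowLen_anti n t ht
      have h5 := lam.rowLen_anti n t ht
      rw [hn l hl] at h4
      rw [hn lam hlam] at h5
      omega
  · intro h
    exact (h hlam).elim

/-! ### Littlewood–Richardson sequences as dominant patterns -/

section Sequences

variable {mu nu : YoungDiagram} {n : ℕ}

/-- The row lengths of the `i`-th term of a sequence, continued constantly after the last term. -/
noncomputable def rowsAt (q : Fin (u nu 1 + 1) → YoungDiagram) (i t : ℕ) : ℕ :=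
  (q ⟨min i (u nu 1), by omega⟩).rowLen t

/-- The pattern of a sequence: the number of cells in the first `s` rows of the `i`-th strip. -/
noncomputable def pattern (q : Fin (u nu 1 + 1) → YoungDiagram) (s i : ℕ) : ℕ :=
  ∑ t ∈ Finset.range s, (rowsAt q (i + 1) t - rowsAt q i t)

theorem rowsAt_of_le (q : Fin (u nu 1 + 1) → YoungDiagram) {i : ℕ} (h : u nu 1 ≤ i) (t : ℕ) :
    rowsAt q i t = (q (Fin.last _)).rowLen t := by
  have : (⟨min i (u nu 1), by omega⟩ : Fin (u nu 1 + 1)) = Fin.last _ :=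
    Fin.ext (min_eq_right h)
  rw [rowsAt, this]

theorem rowsAt_castSucc (q : Fin (u nu 1 + 1) → YoungDiagram) (i : Fin (u nu 1)) :
    rowsAt q i = (q i.castSucc).rowLen := by
  have : (⟨min i (u nu 1), by omega⟩ : Fin (u nu 1 + 1)) = i.castSucc :=
    Fin.ext (min_eq_left i.2.le)
  funext t
  rw [rowsAt, this]

theorem rowsAt_succ (q : Fin (u nu 1 + 1) → YoungDiagram) (i : Fin (u nu 1)) :
    rowsAt q (i + 1) = (q i.succ).rowLen := by
  have : (⟨min (i + 1) (u nu 1), by omega⟩ : Fin (u nu 1 + 1)) = i.succ :=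
    Fin.ext (min_eq_left i.2)
  funext t
  rw [rowsAt, this]

theorem rowsAt_zero (q : Fin (u nu 1 + 1) → YoungDiagram) : rowsAt q 0 = (q 0).rowLen := by
  have : (⟨min 0 (u nu 1), by omega⟩ : Fin (u nu 1 + 1)) = 0 := Fin.ext (by simp)
  funext t
  rw [rowsAt, this]

theorem eq_of_rowsAt_eq {q q' : Fin (u nu 1 + 1) → YoungDiagram}
    (h : ∀ i t, rowsAt q i t = rowsAt q' i t) : q = q' := by
  funext i
  refine rowLen_injective (funext fun t => ?_)
  have h1 := h i t
  have : (⟨min i (u nu 1), by omega⟩ : Fin (u nu 1 + 1)) = i :=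
    Fin.ext (min_eq_left (Nat.le_of_lt_succ i.2))
  rwa [rowsAt, rowsAt, this] at h1

theorem pattern_succ (q : Fin (u nu 1 + 1) → YoungDiagram) (s i : ℕ) :
    pattern q (s + 1) i = pattern q s i + (rowsAt q (i + 1) s - rowsAt q i s) :=
  Finset.sum_range_succ _ _

theorem pattern_of_le (q : Fin (u nu 1 + 1) → YoungDiagram) (s : ℕ) {i : ℕ} (h : u nu 1 ≤ i) :
    pattern q s i = 0 :=
  Finset.sum_eq_zero fun t _ => by
    rw [rowsAt_of_le q h, rowsAt_of_le q (by omega), Nat.sub_self]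

theorem k_succ (m : ℕ → ℕ → ℕ) (i j : ℕ) :
    k m i j = ∑ t ∈ Finset.range j, m i (t + 1) := by
  rw [k, ← Finset.Ico_add_one_right_eq_Icc, Finset.sum_Ico_eq_sum_range]
  exact Finset.sum_congr (by simp) fun a _ => by rw [add_comm]

namespace IsLRSequence

variable {q : Fin (u nu 1 + 1) → YoungDiagram}

theorem rowsAt_zero_eq (h : IsLRSequence mu nu q) : rowsAt q 0 = mu.rowLen := by
  rw [CodeLR.rowsAt_zero, h.1]

theorem strip (h : IsLRSequence mu nu q) (i t : ℕ) :
    rowsAt q i t ≤ rowsAt q (i + 1) t ∧ rowsAt q (i + 1) (t + 1) ≤ rowsAt q i t := by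
  rcases lt_or_ge i (u nu 1) with hi | hi
  · obtain ⟨_, m, hm, _⟩ := h
    obtain ⟨h1, h2, _⟩ := (isStep_iff _ _ _ _).mp (hm ⟨i, hi⟩)
    rw [← rowsAt_castSucc, ← rowsAt_succ] at h1 h2
    exact ⟨(Nat.le_add_right _ _).trans (h1 t).ge, h2 t⟩
  · rw [rowsAt_of_le q hi, rowsAt_of_le q (by omega), rowsAt_of_le q (by omega)]
    exact ⟨le_rfl, YoungDiagram.rowLen_anti _ _ _ (by omega)⟩

/-- A horizontal strip creates at most one new row. -/
theorem rowsAt_eq_zero (h : IsLRSequence mu nu q) {i t : ℕ} (ht : mu.colLen 0 + i ≤ t) :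
    rowsAt q i t = 0 := by
  induction i generalizing t with
  | zero => rw [h.rowsAt_zero_eq, rowLen_eq_zero (by omega)]
  | succ i ih =>
    obtain ⟨t, rfl⟩ : ∃ t', t = t' + 1 := ⟨t - 1, by omega⟩
    have h1 := (h.strip i t).2
    have h2 := ih (t := t) (by omega)
    omega

/-- Column `i` of the pattern consists of the partial sums `k m (i + 1)`. So `inter` is condition 2,
and `top` says that step `i + 1` makes `nu.rowLen i` switches in all. -/
theorem isGT_pattern (h : IsLRSequence mu nu q) (hn : mu.colLen 0 + nu.colLen 0 ≤ n) :
    IsGT n nu.rowLen (pattern q) := by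
  have hu := u_one nu
  have hs := h.strip
  have hz := fun i t => h.rowsAt_eq_zero (i := i) (t := t)
  obtain ⟨_, m, hm, hk⟩ := h
  have hstep : ∀ i, i < u nu 1 → (∀ s, pattern q s i = k m (i + 1) s) ∧
      ∀ s, n ≤ s → pattern q s i = nu.rowLen i := by
    intro i hi
    obtain ⟨h1, h2, h3, h4⟩ := (isStep_iff _ _ _ _).mp (hm ⟨i, hi⟩)
    rw [r_succ] at h4
    rw [← rowsAt_succ, ← rowsAt_castSucc] at h1
    have hpk : ∀ s, pattern q s i = k m (i + 1) s := fun s => by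
      rw [k_succ, pattern]
      refine Finset.sum_congr rfl fun t _ => ?_
      have := h1 t
      dsimp only at this
      omega
    refine ⟨hpk, fun s hs' => ?_⟩
    rw [hpk, k_succ, ← h4]
    -- All U's of the sweep are among the first `n`: the diagram has at most `mu.colLen 0 + i` rows,
    -- and `i < nu.colLen 0`.
    have hc : (q (Fin.castSucc ⟨i, hi⟩)).colLen 0 + 1 ≤ n := by
      by_contra hc
      have h5 := lt_colLen_iff.mp (show n - 1 < (q (Fin.castSucc ⟨i, hi⟩)).colLen 0 by omega)
      rw [← rowsAt_castSucc] at h5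
      have h6 := hz i (n - 1) (by omega)
      dsimp only at h5
      omega
    symm
    refine Finset.sum_subset (fun a ha => by
      rw [Finset.mem_range] at ha ⊢; omega) fun a _ ha => ?_
    rw [Finset.mem_range, not_lt] at ha
    obtain ⟨b, rfl⟩ : ∃ b, a = b + 1 := ⟨a - 1, by omega⟩
    have h5 := rowLen_eq_zero (lam := q (Fin.castSucc ⟨i, hi⟩)) (n := b)
      (by omega)
    rw [← rowsAt_castSucc] at h5
    have h6 := (hs i b).2
    have h7 := h1 (b + 1)
    dsimp only at h5 h7
    dsimp only
    omega
  refine ⟨fun i => rfl, fun s i => ?_, fun s i => ?_, fun s hs' i => ?_⟩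
  · rw [pattern_succ]
    omega
  · rcases lt_or_ge (i + 1) (u nu 1) with hi | hi
    · rw [(hstep _ hi).1, (hstep i (by omega)).1]
      exact hk (i + 2) (s + 1) (by omega) (by omega) (by omega)
    · rw [pattern_of_le q _ hi]
      omega
  · rcases lt_or_ge i (u nu 1) with hi | hi
    · exact (hstep i hi).2 s hs'
    · rw [pattern_of_le q _ hi, rowLen_eq_zero (by omega)]

/-- The first `i` rows of the companion tableau record the first `i` strips, so the sequence is
recovered from its pattern. -/
theorem shapeAt_pattern (h : IsLRSequence mu nu q) (i t : ℕ) :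
    shapeAt mu.rowLen (pattern q) i t = rowsAt q i t := by
  have hg := h.isGT_pattern le_rfl
  induction i with
  | zero => simp [shapeAt, h.rowsAt_zero_eq]
  | succ i ih =>
    have h1 := hg.shapeAt_succ mu.rowLen i t
    have h2 := pattern_succ q t i
    have h3 := (h.strip i t).1
    omega

theorem dominant_pattern (h : IsLRSequence mu nu q) : Dominant n mu.rowLen (pattern q) := by
  rintro i t ⟨_, h1⟩
  rw [h.shapeAt_pattern, h.shapeAt_pattern] at h1
  have := (h.strip i t).2
  omega

end IsLRSequence

theorem pattern_injOn : Set.InjOn pattern {q | IsLRSequence mu nu q} := by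
  intro q hq q' hq' h
  refine eq_of_rowsAt_eq fun i t => ?_
  rw [← IsLRSequence.shapeAt_pattern hq, ← IsLRSequence.shapeAt_pattern hq', h]

/-- The diagram with given row lengths. -/
def diagramOf (f : ℕ → ℕ) (n : ℕ) (hf : Antitone f) : YoungDiagram where
  cells := (Finset.range n ×ˢ Finset.range (f 0)).filter fun p => p.2 < f p.1
  isLowerSet := by
    intro a b hab ha
    have h1 : b.1 ≤ a.1 := hab.1
    have h2 : b.2 ≤ a.2 := hab.2
    have h3 := hf h1
    simp only [Finset.coe_filter, Finset.mem_product, Finset.mem_range, Set.mem_ofPred_eq] at ha ⊢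
    omega

theorem rowLen_diagramOf {f : ℕ → ℕ} {n : ℕ} (hf : Antitone f) (h0 : f n = 0) :
    (diagramOf f n hf).rowLen = f := by
  funext i
  refine eq_of_forall_lt_iff fun j => ?_
  rw [← YoungDiagram.mem_iff_lt_rowLen, ← YoungDiagram.mem_cells]
  simp only [diagramOf, Finset.mem_filter, Finset.mem_product, Finset.mem_range]
  refine ⟨fun h => h.2, fun h => ⟨⟨?_, ?_⟩, h⟩⟩
  · by_contra hi
    have := hf (show n ≤ i by omega)
    omega
  · have := hf (Nat.zero_le i)
    omega

/-- The `i`-th diagram has the row lengths `shapeAt mu.rowLen g i`. Dominance makes these partitions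
and makes successive differences horizontal strips. -/
theorem exists_pattern_eq {g : ℕ → ℕ → ℕ} (hg : IsGT n nu.rowLen g)
    (hd : Dominant n mu.rowLen g) (hn : mu.colLen 0 ≤ n) :
    ∃ q : Fin (u nu 1 + 1) → YoungDiagram, IsLRSequence mu nu q ∧ pattern q = g := by
  have hmu : ∀ t, n ≤ t → mu.rowLen t = 0 := fun t ht => rowLen_eq_zero (hn.trans ht)
  have hz : ∀ i t, n ≤ t → shapeAt mu.rowLen g i t = 0 := fun i t ht => by
    rw [shapeAt_eq_add, hg.shapeAt_zero_of_le ht, hmu t ht]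
  have hanti : ∀ i, Antitone (shapeAt mu.rowLen g i) := fun i =>
    antitone_nat_of_succ_le fun t => by
      rcases lt_or_ge (t + 1) n with ht | ht
      · exact hg.shapeAt_antitone_of_not_fails (antitone_rowLen mu) (fun i' _ => hd i') ht
      · rw [hz i (t + 1) ht]
        omega
  have hstrip : ∀ i t, shapeAt mu.rowLen g (i + 1) (t + 1) ≤ shapeAt mu.rowLen g i t := by
    intro i t
    rcases lt_or_ge (t + 1) n with ht | ht
    · by_contra h
      exact hd i t ⟨ht, by omega⟩
    · rw [hz (i + 1) (t + 1) ht]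
      omega
  let q : Fin (u nu 1 + 1) → YoungDiagram := fun i => diagramOf _ n (hanti i)
  have hq : ∀ i, (q i).rowLen = shapeAt mu.rowLen g i := fun i =>
    rowLen_diagramOf (hanti i) (hz i n le_rfl)
  have hu := u_one nu
  have hsum : ∀ s i, ∑ t ∈ Finset.range s, (g (t + 1) i - g t i) = g s i := fun s i => by
    rw [Finset.sum_range_tsub (f := fun s => g s i) (hg.monotone i), hg.zero, Nat.sub_zero]
  -- Steps and U's count from `1`, rows from `0`, hence the shift `i - 1`. At `t = 0` truncated
  -- subtraction gives the required value `0`.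
  refine ⟨q, ⟨?_, fun i t => g t (i - 1) - g (t - 1) (i - 1), fun i => ?_, ?_⟩, ?_⟩
  · refine rowLen_injective ?_
    rw [hq]
    funext t
    simp [shapeAt]
  · rw [isStep_iff, r_succ, hq, hq]
    simp only [Fin.val_succ, Fin.val_castSucc, Nat.add_sub_cancel, Nat.zero_sub, Nat.sub_self,
      true_and]
    refine ⟨fun a => ?_, hstrip i, ?_⟩
    · have h1 := hg.shapeAt_succ mu.rowLen i a
      have h2 := hg.mono a i
      omega
    · have hc : ∀ s, (q i.castSucc).colLen 0 + 1 ≤ s → g (s + 1) i = g s i := by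
        intro s hs
        obtain ⟨b, rfl⟩ : ∃ b, s = b + 1 := ⟨s - 1, by omega⟩
        have h1 := rowLen_eq_zero (lam := q i.castSucc) (n := b) (by omega)
        rw [hq] at h1
        have h2 := hstrip i b
        have h3 := hg.shapeAt_succ mu.rowLen i (b + 1)
        have h4 := hg.mono (b + 1) i
        rw [Fin.val_castSucc] at h1
        omega
      have hc' : ∀ s, (q i.castSucc).colLen 0 + 1 ≤ s →
          g s i = g ((q i.castSucc).colLen 0 + 1) i := by
        intro s hs
        induction s, hs using Nat.le_induction with
        | base => rfl
        | succ s hs ih => rw [hc s hs, ih]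
      rw [hsum, ← hc' (max n ((q i.castSucc).colLen 0 + 1)) (le_max_right _ _),
        hg.top _ (le_max_left _ _)]
  · intro i j hi _ hj
    obtain ⟨i, rfl⟩ : ∃ i', i = i' + 2 := ⟨i - 2, by omega⟩
    obtain ⟨j, rfl⟩ : ∃ j', j = j' + 1 := ⟨j - 1, by omega⟩
    rw [k_succ, k_succ]
    simp only [Nat.add_sub_cancel]
    rw [show i + 2 - 1 = i + 1 from rfl, hsum, Nat.add_sub_cancel, hsum]
    exact hg.inter j i
  · funext s i
    rcases lt_or_ge i (u nu 1) with hi | hi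
    · rw [← hsum s i, pattern]
      refine Finset.sum_congr rfl fun t _ => ?_
      have h1 := congrFun (rowsAt_castSucc q ⟨i, hi⟩) t
      have h2 := congrFun (rowsAt_succ q ⟨i, hi⟩) t
      rw [hq] at h1 h2
      have h3 := hg.shapeAt_succ mu.rowLen i t
      have h4 := hg.mono t i
      simp only [Fin.val_succ, Fin.castSucc_mk] at h1 h2
      omega
    · rw [pattern_of_le q s hi]
      have h1 := hg.le_shape s i
      rw [rowLen_eq_zero (by omega)] at h1
      omega

/-! ### The product of two Schur functions -/

theorem finite_setOf_isLRSequence (mu nu : YoungDiagram) :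
    {q : Fin (u nu 1 + 1) → YoungDiagram | IsLRSequence mu nu q}.Finite :=
  Set.Finite.of_injOn (t := {g | IsGT (mu.colLen 0 + nu.colLen 0) nu.rowLen g})
    (fun _ hq => IsLRSequence.isGT_pattern hq le_rfl) pattern_injOn (finite_setOf_isGT _ _)

/-- After multiplication by `alt (rho n)` both sides are sums of alternants, matched by `pattern`.
The bound on `n` ensures that every final diagram has at most `n` rows. -/
theorem schurPoly_mul_schurPoly (hn : mu.colLen 0 + nu.colLen 0 ≤ n) :
    schurPoly n mu.rowLen * schurPoly n nu.rowLen =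
      ∑ q ∈ (finite_setOf_isLRSequence mu nu).toFinset,
        schurPoly n (q (Fin.last (u nu 1))).rowLen := by
  classical
  have hu := u_one nu
  have hlr : ∀ q ∈ (finite_setOf_isLRSequence mu nu).toFinset, IsLRSequence mu nu q :=
    fun q hq => by simpa using hq
  refine mul_right_cancel₀ (alt_rho_ne_zero (n := n)) ?_
  rw [mul_right_comm, schurPoly_mul_alt_rho (antitone_rowLen mu) (rowLen_eq_zero (by omega)),
    mul_comm, schurPoly_mul_alt (antitone_rowLen mu), Finset.sum_mul]
  symm
  refine Finset.sum_nbij pattern (fun q hq => ?_) (fun q hq q' hq' => ?_) (fun g hg => ?_)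
    fun q hq => ?_
  · rw [Finset.mem_filter, mem_gts]
    exact ⟨(hlr q hq).isGT_pattern hn, (hlr q hq).dominant_pattern⟩
  · exact pattern_injOn (hlr q hq) (hlr q' hq')
  · rw [Finset.mem_coe, Finset.mem_filter, mem_gts] at hg
    obtain ⟨q, hq, rfl⟩ := exists_pattern_eq hg.1 hg.2 (by omega)
    exact ⟨q, by simpa using hq, rfl⟩
  · have h := hlr q hq
    have hrow : ∀ t, (q (Fin.last (u nu 1))).rowLen t = rowsAt q n t := fun t =>
      (rowsAt_of_le q (by omega) t).symm
    rw [schurPoly_mul_alt_rho (antitone_rowLen _)]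
    · simp only [hrow, h.shapeAt_pattern]
    · rw [← rowsAt_of_le q le_rfl, h.rowsAt_eq_zero (by omega)]

theorem schur_mul_schur (mu nu : YoungDiagram) :
    schur mu * schur nu = ∑ q ∈ (finite_setOf_isLRSequence mu nu).toFinset,
      schur (q (Fin.last (u nu 1))) := by
  ext d
  obtain ⟨n₀, hn₀⟩ := exists_bound d
  -- The number of variables must cover both the monomial and the rows of all diagrams that occur.
  have hd := hn₀ (max n₀ (mu.colLen 0 + nu.colLen 0))
  replace hd := fun t => hd t (le_max_left _ _)
  rw [← coeff_rename_mul_schurPoly _ _ hd, schurPoly_mul_schurPoly (le_max_right _ _), map_sum,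
    map_sum, MvPolynomial.coeff_sum]
  exact Finset.sum_congr rfl fun q _ => coeff_rename_schurPoly _ hd

theorem isSchurExpansion_iff (f : MvPowerSeries ℕ ℂ) (c : YoungDiagram →₀ ℂ) :
    IsSchurExpansion f c ↔ f = Finsupp.linearCombination ℂ schur c := Iff.rfl

theorem isSchurExpansion_sum_single (mu nu : YoungDiagram) :
    IsSchurExpansion (schur mu * schur nu)
      (∑ q ∈ (finite_setOf_isLRSequence mu nu).toFinset,
        Finsupp.single (q (Fin.last (u nu 1))) 1) := by
  rw [isSchurExpansion_iff, map_sum, schur_mul_schur]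
  exact Finset.sum_congr rfl fun q _ => by rw [Finsupp.linearCombination_single, one_smul]

theorem IsSchurExpansion.unique {f : MvPowerSeries ℕ ℂ} {c c' : YoungDiagram →₀ ℂ}
    (h : IsSchurExpansion f c) (h' : IsSchurExpansion f c') : c = c' :=
  linearIndependent_schur (h.symm.trans h')

end Sequences

end CodeLR

open CodeLR
theorem theorem5 (mu nu : YoungDiagram) :
    (∃! c : YoungDiagram →₀ ℂ, IsSchurExpansion (schur mu * schur nu) c) ∧
    (∃ hfin : {q : Fin (u nu 1 + 1) → YoungDiagram | IsLRSequence mu nu q}.Finite,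
      schur mu * schur nu = ∑ q ∈ hfin.toFinset, schur (q (Fin.last (u nu 1)))) ∧
    (∀ c : YoungDiagram →₀ ℂ, IsSchurExpansion (schur mu * schur nu) c →
      ∀ lam : YoungDiagram, c lam =
        (Nat.card {q : Fin (u nu 1 + 1) → YoungDiagram //
          IsLRSequence mu nu q ∧ q (Fin.last (u nu 1)) = lam} : ℂ)) := by
  classical
  have hex := isSchurExpansion_sum_single mu nu
  refine ⟨⟨_, hex, fun c hc => hc.unique hex⟩,
    ⟨finite_setOf_isLRSequence mu nu, schur_mul_schur mu nu⟩, fun c hc lam => ?_⟩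
  rw [hc.unique hex, Finsupp.finsetSum_apply]
  simp only [Finsupp.single_apply]
  rw [← Finset.natCast_card_filter]
  congr 1
  symm
  refine Nat.subtype_card _ fun q => ?_
  simp
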